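/- Let $R>0$. A hyperbolic pair of pants with cuffs of length $R$ is the compact hyperbolic surface with three boundary geodesics of length $R$ obtained by gluing two copies of the right-angled hexagon with three alternate sides of length $R/2$ along the three other sides (the seams). A surface of type $R$ is a closed oriented hyperbolic surface obtained by gluing finitely many such pairs of pants along their boundary geodesics so that all shear parameters are equal to $1$. Here, when two boundary geodesics, each oriented with its pair of pants on the left, are glued to one closed geodesic of the surface, the shear parameter is the class $t\in\mathbb{R}/(R/2)\mathbb{Z}$ such that advancing by $t$ along the first one leads from the endpoints of its seams to the endpoints of the seams of the second one. The cuffs of the surface are these closed geodesics, of length $R$. Proposition. There are constants $R_0$ and $C$ such that for all $R\ge R_0$, every geodesic segment of length $\ell$ on a surface of type $R$ that is not contained in a cuff meets the cuffs at most $C\,R\,\max(\ell,1)$ times; in particular at most $C R\ell$ times if $\ell\ge 1$. -/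

import Mathlib

open scoped UpperHalfPlane MatrixGroups

noncomputable section

namespace HypSurf

/-! ### Frames of the hyperbolic plane

A matrix `f` in `SL(2, ℝ)` stands for the unit tangent vector of `ℍ` which is the image under `f` of
the upward vertical unit vector at `i`. Up to sign, every unit tangent vector of `ℍ` is obtained
exactly once. -/

/-- The frame `f * trans t` is obtained from `f` by advancing by `t` along the geodesic that is
tangent to `f`. -/
def trans (t : ℝ) : SL(2, ℝ) :=
  ⟨!![Real.exp (t / 2), 0; 0, Real.exp (-(t / 2))], by
    rw [Matrix.det_fin_two_of, ← Real.exp_add]; simp⟩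

/-- The frame `f * rot θ` is obtained from `f` by turning counterclockwise by the angle `θ` around
the base point of `f`. -/
def rot (θ : ℝ) : SL(2, ℝ) :=
  ⟨!![Real.cos (θ / 2), Real.sin (θ / 2); -Real.sin (θ / 2), Real.cos (θ / 2)], by
    rw [Matrix.det_fin_two_of]; nlinarith [Real.sin_sq_add_cos_sq (θ / 2)]⟩

theorem coe_trans (t : ℝ) : (trans t : Matrix (Fin 2) (Fin 2) ℝ) =
    !![Real.exp (t / 2), 0; 0, Real.exp (-(t / 2))] := rfl

theorem coe_rot (θ : ℝ) : (rot θ : Matrix (Fin 2) (Fin 2) ℝ) =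
    !![Real.cos (θ / 2), Real.sin (θ / 2); -Real.sin (θ / 2), Real.cos (θ / 2)] := rfl

/-- The closed half-plane on the left of the oriented geodesic tangent to `f`. -/
def leftHalfPlane (f : SL(2, ℝ)) : Set ℍ := {z | (f⁻¹ • z).re ≤ 0}

/-- The complete geodesic tangent to the frame `f`. -/
def geodesicLine (f : SL(2, ℝ)) : Set ℍ := Set.range fun t : ℝ => (f * trans t) • UpperHalfPlane.I

/-! ### Right-angled hexagons and pairs of pants

A hyperbolic pair of pants with three boundary geodesics of length `R` is obtained from two right-angled
hexagons, each with three alternate sides of length `R / 2`, by gluing them along the three other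
sides (the seams). Such a hexagon is unique up to isometry, and its seams all have the same length. -/

/-- The length of the seams, the three other sides of the right-angled hexagon which has three
alternate sides of length `R / 2`. -/
def seamLength (R : ℝ) : ℝ := 2 * Real.arsinh (1 / (2 * Real.sinh (R / 4)))

/-- One third of the way around the hexagon, counterclockwise: a side of length `R / 2`, a left turn
by a right angle, a seam, and another left turn by a right angle. -/
def hexStep (R : ℝ) : SL(2, ℝ) :=
  trans (R / 2) * rot (Real.pi / 2) * trans (seamLength R) * rot (Real.pi / 2)

/-- The hexagon closes up: after three steps one is back at the same frame (up to the sign, which is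
irrelevant for frames). -/
theorem hexStep_pow_three {R : ℝ} (hR : 0 < R) : hexStep R ^ 3 = -1 := by
  have hs : 0 < Real.sinh (R / 4) := Real.sinh_pos_iff.mpr (by linarith)
  have hd : Real.sinh (Real.arsinh (1 / (2 * Real.sinh (R / 4)))) * (2 * Real.sinh (R / 4)) = 1 := by
    rw [Real.sinh_arsinh]; field_simp
  have h2 : Real.sqrt 2 * Real.sqrt 2 = 2 := Real.mul_self_sqrt (by norm_num)
  obtain ⟨M, hM⟩ : ∃ M : Matrix (Fin 2) (Fin 2) ℝ, (hexStep R : Matrix (Fin 2) (Fin 2) ℝ) = M :=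
    ⟨_, rfl⟩
  have hdet : M 0 0 * M 1 1 - M 0 1 * M 1 0 = 1 := by
    rw [← Matrix.det_fin_two, ← hM]; exact (hexStep R).2
  have htr : M 0 0 + M 1 1 = 1 := by
    rw [← hd, ← hM]
    simp only [hexStep, Matrix.SpecialLinearGroup.coe_mul, coe_trans, coe_rot, seamLength]
    rw [show Real.pi / 2 / 2 = Real.pi / 4 by ring, Real.cos_pi_div_four, Real.sin_pi_div_four,
      show R / 2 / 2 = R / 4 by ring, mul_div_cancel_left₀ _ (two_ne_zero)]
    simp [Matrix.mul_apply, Fin.sum_univ_two, Real.sinh_eq]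
    ring_nf
    rw [Real.sq_sqrt (by norm_num)]
    ring
  have hM1 : M 1 1 = 1 - M 0 0 := by linarith
  rw [hM1] at hdet
  apply Subtype.ext
  rw [Matrix.SpecialLinearGroup.coe_pow, hM, Matrix.SpecialLinearGroup.coe_neg,
    Matrix.SpecialLinearGroup.coe_one, pow_succ, pow_two]
  ext i j
  fin_cases i <;> fin_cases j <;> simp [Matrix.mul_apply, Fin.sum_univ_two, hM1]
  · linear_combination (-M 0 0 - 1) * hdet
  · linear_combination (-M 0 1) * hdet
  · linear_combination (-M 1 0) * hdet
  · linear_combination (M 0 0 - 2) * hdet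

/-- The frame at the beginning of the `i`-th side of length `R / 2` of the hexagon that starts at the
frame `f`; the hexagon is on its left. -/
def cuffFrame (R : ℝ) (f : SL(2, ℝ)) (i : Fin 3) : SL(2, ℝ) := f * hexStep R ^ (i : ℕ)

/-- The frame at the beginning of the `i`-th seam of the hexagon that starts at the frame `f`. -/
def seamFrame (R : ℝ) (f : SL(2, ℝ)) (i : Fin 3) : SL(2, ℝ) :=
  cuffFrame R f i * trans (R / 2) * rot (Real.pi / 2)

/-- The closed right-angled hexagon with three alternate sides of length `R / 2` that lies on the left
of the frame `f` and has one of these sides starting at `f`. -/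
def hexagon (R : ℝ) (f : SL(2, ℝ)) : Set ℍ :=
  ⋂ i : Fin 3, leftHalfPlane (cuffFrame R f i) ∩ leftHalfPlane (seamFrame R f i)

/-- The two hexagons of a pair of pants, lifted to `ℍ`: the hexagon that starts at `f`, and its
reflection in the first seam, which starts at the frame `f * trans (R / 2)`. -/
def pantsHexagon (R : ℝ) (f : SL(2, ℝ)) : Bool → Set ℍ
  | false => hexagon R f
  | true => hexagon R (f * trans (R / 2))

/-! ### Hyperbolic surfaces -/

/-- The quotient of the hyperbolic plane by a group of direct isometries. -/
abbrev Surf (Γ : Subgroup SL(2, ℝ)) : Type := MulAction.orbitRel.Quotient Γ ℍ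

/-- The projection from `ℍ` to the quotient. -/
def proj (Γ : Subgroup SL(2, ℝ)) (z : ℍ) : Surf Γ := Quotient.mk _ z

/-- `Γ` is the preimage in `SL(2, ℝ)` of a subgroup of `PSL(2, ℝ)` that acts freely and properly
discontinuously on `ℍ`, so that `Surf Γ` is an oriented complete hyperbolic surface. -/
structure IsSurfaceGroup (Γ : Subgroup SL(2, ℝ)) : Prop where
  neg_one_mem : -1 ∈ Γ
  properlyDiscontinuous : ProperlyDiscontinuousSMul Γ ℍ
  free : ∀ γ ∈ Γ, ∀ z : ℍ, γ • z = z → γ = 1 ∨ γ = -1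

/-- Two boundary curves of pants, both of length `R` and with the pants on their left, project to the same
closed geodesic of `Surf Γ` with opposite orientations, with shear parameter `t`. Here `g` and `h` are
lifts of frames tangent to these two curves at feet of seams; there are two feet on each of the curves, at
distance `R / 2` from each other, so that `t` only matters modulo `R / 2`. The condition says that
advancing by `t` along the first curve leads from its feet to the feet on the second curve. -/
def GluedWithShear (Γ : Subgroup SL(2, ℝ)) (R : ℝ) (g h : SL(2, ℝ)) (t : ℝ) : Prop :=
  ∃ γ ∈ Γ, ∃ n : ℤ, γ * h = g * trans (t + n * (R / 2)) * rot Real.pi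

/-- A surface of type `R`: a closed oriented hyperbolic surface with a decomposition into finitely many pairs
of pants, all of whose cuffs have length `R` and all of whose shear parameters are `1`. -/
structure SurfaceOfType (R : ℝ) where
  /-- The Fuchsian group of the surface. -/
  Γ : Subgroup SL(2, ℝ)
  isSurfaceGroup : IsSurfaceGroup Γ
  /-- The set of pairs of pants. -/
  Pants : Type
  finite_pants : Finite Pants
  /-- The position of a lift to `ℍ` of each of the pants. -/
  frame : Pants → SL(2, ℝ)
  /-- The translation of length `R` along each of the three boundary geodesics belongs to `Γ`. Hence
  the two hexagons of each of the pants are glued in the surface along all three seams, and the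
  boundary curves are closed. -/
  boundary_mem : ∀ (p : Pants) (i : Fin 3),
    cuffFrame R (frame p) i * trans R * (cuffFrame R (frame p) i)⁻¹ ∈ Γ
  /-- The pants cover the surface. -/
  cover : ∀ x : Surf Γ, ∃ (p : Pants) (b : Bool), x ∈ proj Γ '' pantsHexagon R (frame p) b
  /-- The interiors of the hexagons are embedded in the surface and pairwise disjoint. -/
  disjoint : ∀ (p q : Pants) (b c : Bool),
    ∀ z ∈ interior (pantsHexagon R (frame p) b), ∀ w ∈ interior (pantsHexagon R (frame q) c),
      proj Γ z = proj Γ w → p = q ∧ b = c ∧ z = w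
  /-- Each boundary curve of the pants is glued to exactly one other boundary curve. -/
  glue : Pants × Fin 3 → Pants × Fin 3
  glue_involutive : Function.Involutive glue
  glue_ne : ∀ e, glue e ≠ e
  /-- All shear parameters are equal to `1`. -/
  shear_eq_one : ∀ e : Pants × Fin 3,
    GluedWithShear Γ R (cuffFrame R (frame e.1) e.2)
      (cuffFrame R (frame (glue e).1) (glue e).2) 1

namespace SurfaceOfType

variable {R : ℝ}

/-- The underlying space of a surface of type `R`. -/
abbrev carrier (S : SurfaceOfType R) : Type := Surf S.Γ

/-- The union of the cuffs, the closed geodesics that cut the surface into pants. -/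
def cuffs (S : SurfaceOfType R) : Set S.carrier :=
  ⋃ (p : S.Pants) (i : Fin 3), proj S.Γ '' geodesicLine (cuffFrame R (S.frame p) i)

/-- `c : [0, ℓ] → S` is a geodesic segment of length `ℓ`, parametrized by arc length: it is the projection
of a geodesic segment of the hyperbolic plane. -/
def IsGeodesicSegment (S : SurfaceOfType R) (ℓ : ℝ) (c : Set.Icc (0 : ℝ) ℓ → S.carrier) : Prop :=
  ∃ g : Set.Icc (0 : ℝ) ℓ → ℍ, Isometry g ∧ ∀ t, c t = proj S.Γ (g t)

end SurfaceOfType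

end HypSurf

end

namespace HypSurf

open UpperHalfPlane

/-! ### Frame algebra -/

theorem trans_add (s t : ℝ) : trans (s + t) = trans s * trans t := by
  ext i j
  rw [Matrix.SpecialLinearGroup.coe_mul, coe_trans, coe_trans, coe_trans]
  fin_cases i <;> fin_cases j <;> simp [Matrix.mul_apply, Fin.sum_univ_two, ← Real.exp_add] <;> ring

theorem trans_zero : trans 0 = 1 := by
  ext i j
  rw [coe_trans]
  fin_cases i <;> fin_cases j <;> simp

theorem trans_neg (t : ℝ) : trans (-t) = (trans t)⁻¹ := by
  rw [eq_inv_iff_mul_eq_one, ← trans_add, neg_add_cancel, trans_zero]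

theorem trans_zpow (t : ℝ) (n : ℤ) : trans t ^ n = trans (n * t) := by
  have key : ∀ n : ℕ, trans t ^ n = trans (n * t) := fun n ↦ by
    induction n with
    | zero => simp [trans_zero]
    | succ n ih => rw [pow_succ, ih, ← trans_add]; push_cast; ring_nf
  obtain ⟨k, rfl | rfl⟩ := n.eq_nat_or_neg
  · rw [zpow_natCast, key]; simp
  · rw [zpow_neg, zpow_natCast, key, ← trans_neg]; push_cast; ring_nf

theorem rot_pi_mul_trans (t : ℝ) : rot Real.pi * trans t = trans (-t) * rot Real.pi := by
  ext i j
  rw [Matrix.SpecialLinearGroup.coe_mul, Matrix.SpecialLinearGroup.coe_mul, coe_rot, coe_trans,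
    coe_trans, Real.cos_pi_div_two, Real.sin_pi_div_two]
  fin_cases i <;> fin_cases j <;> simp [Matrix.mul_apply, Fin.sum_univ_two, neg_div]

/-- The left turn by a right angle. -/
noncomputable def leftTurn : SL(2, ℝ) := rot (Real.pi / 2)

/-- The passage along a seam: a left turn, a seam, and another left turn. -/
noncomputable def crossSeam (R : ℝ) : SL(2, ℝ) := leftTurn * trans (seamLength R) * leftTurn

theorem hexStep_eq (R : ℝ) : hexStep R = trans (R / 2) * crossSeam R := by
  simp [hexStep, crossSeam, leftTurn, mul_assoc]

theorem coe_leftTurn : (leftTurn : Matrix (Fin 2) (Fin 2) ℝ) =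
    !![Real.sqrt 2 / 2, Real.sqrt 2 / 2; -(Real.sqrt 2 / 2), Real.sqrt 2 / 2] := by
  rw [leftTurn, coe_rot, show Real.pi / 2 / 2 = Real.pi / 4 by ring, Real.cos_pi_div_four,
    Real.sin_pi_div_four]

theorem coe_crossSeam (R : ℝ) : (crossSeam R : Matrix (Fin 2) (Fin 2) ℝ) =
    !![Real.sinh (seamLength R / 2), Real.cosh (seamLength R / 2);
      -Real.cosh (seamLength R / 2), -Real.sinh (seamLength R / 2)] := by
  have h2 : Real.sqrt 2 * Real.sqrt 2 = 2 := Real.mul_self_sqrt (by norm_num)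
  rw [crossSeam, Matrix.SpecialLinearGroup.coe_mul, Matrix.SpecialLinearGroup.coe_mul, coe_leftTurn,
    coe_trans]
  ext i j
  fin_cases i <;> fin_cases j <;>
    simp [Matrix.mul_apply, Fin.sum_univ_two, Real.sinh_eq, Real.cosh_eq]
  · linear_combination
      (Real.exp (seamLength R / 2) / 4 - Real.exp (-(seamLength R / 2)) / 4) * h2
  · linear_combination
      (Real.exp (seamLength R / 2) / 4 + Real.exp (-(seamLength R / 2)) / 4) * h2
  · linear_combination
      (-Real.exp (seamLength R / 2) / 4 - Real.exp (-(seamLength R / 2)) / 4) * h2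
  · linear_combination
      (-Real.exp (seamLength R / 2) / 4 + Real.exp (-(seamLength R / 2)) / 4) * h2

theorem crossSeam_mul_crossSeam (R : ℝ) : crossSeam R * crossSeam R = -1 := by
  have h := Real.cosh_sq (seamLength R / 2)
  ext i j
  rw [Matrix.SpecialLinearGroup.coe_mul, coe_crossSeam, Matrix.SpecialLinearGroup.coe_neg,
    Matrix.SpecialLinearGroup.coe_one]
  fin_cases i <;> fin_cases j <;> simp [Matrix.mul_apply, Fin.sum_univ_two] <;> linarith

theorem crossSeam_inv (R : ℝ) : (crossSeam R)⁻¹ = -crossSeam R := by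
  rw [inv_eq_iff_mul_eq_one, mul_neg, crossSeam_mul_crossSeam, neg_neg]

theorem sinh_half_seamLength (R : ℝ) :
    Real.sinh (seamLength R / 2) = 1 / (2 * Real.sinh (R / 4)) := by
  rw [seamLength, mul_div_cancel_left₀ _ two_ne_zero, Real.sinh_arsinh]

theorem hexStep_zpow_three {R : ℝ} (hR : 0 < R) : hexStep R ^ (3 : ℤ) = -1 := by
  rw [← hexStep_pow_three hR]; rfl

/-! ### The signed distance to a geodesic -/

/-- The hyperbolic sine of the signed distance from `z` to the oriented geodesic tangent to `f`,
counted positively on the right. -/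
noncomputable def offset (f : SL(2, ℝ)) (z : ℍ) : ℝ := (f⁻¹ • z).re / (f⁻¹ • z).im

theorem re_div_im_smul_I (m : SL(2, ℝ)) : (m • I).re / (m • I).im = m 0 0 * m 1 0 + m 0 1 * m 1 1 := by
  have hdet : m 0 0 * m 1 1 - m 0 1 * m 1 0 = 1 := by rw [← Matrix.det_fin_two]; exact m.2
  have hpos : 0 < m 1 0 ^ 2 + m 1 1 ^ 2 := by
    by_contra! h
    have h0 : m 1 0 = 0 := by nlinarith [sq_nonneg (m 1 0), sq_nonneg (m 1 1)]
    have h1 : m 1 1 = 0 := by nlinarith [sq_nonneg (m 1 0), sq_nonneg (m 1 1)]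
    rw [h0, h1] at hdet; norm_num at hdet
  have hne : m 1 0 * m 1 0 + m 1 1 * m 1 1 ≠ 0 := by nlinarith
  have him : (m • I).im = 1 / (m 1 0 * m 1 0 + m 1 1 * m 1 1) := by
    rw [← coe_im, coe_specialLinearGroup_apply]
    simp only [Algebra.algebraMap_self, RingHom.id_apply, coe_I, Complex.div_im, Complex.normSq_apply,
      Complex.add_im, Complex.add_re, Complex.mul_im, Complex.mul_re, Complex.ofReal_re,
      Complex.ofReal_im, Complex.I_re, Complex.I_im]
    rw [show ∀ a b : ℝ, (a * 0 - 0 * 1 + b) * (a * 0 - 0 * 1 + b) +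
      (a * 1 + 0 * 0 + 0) * (a * 1 + 0 * 0 + 0) = a * a + b * b by intros; ring, ← sub_div]
    congr 1
    linear_combination hdet
  have hre : (m • I).re = (m 0 0 * m 1 0 + m 0 1 * m 1 1) / (m 1 0 * m 1 0 + m 1 1 * m 1 1) := by
    rw [← coe_re, coe_specialLinearGroup_apply]
    simp only [Algebra.algebraMap_self, RingHom.id_apply, coe_I, Complex.div_re, Complex.normSq_apply,
      Complex.add_im, Complex.add_re, Complex.mul_im, Complex.mul_re, Complex.ofReal_re,
      Complex.ofReal_im, Complex.I_re, Complex.I_im]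
    rw [show ∀ a b : ℝ, (a * 0 - 0 * 1 + b) * (a * 0 - 0 * 1 + b) +
      (a * 1 + 0 * 0 + 0) * (a * 1 + 0 * 0 + 0) = a * a + b * b by intros; ring, ← add_div]
    congr 1
    ring
  rw [him, hre]
  field_simp

theorem offset_mul_smul_I (f m : SL(2, ℝ)) :
    offset f ((f * m) • I) = m 0 0 * m 1 0 + m 0 1 * m 1 1 := by
  rw [offset, ← mul_smul, inv_mul_cancel_left, re_div_im_smul_I]

theorem exists_eq_mul_smul_I (f : SL(2, ℝ)) (z : ℍ) : ∃ m : SL(2, ℝ), z = (f * m) • I := by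
  obtain ⟨m, hm⟩ := MulAction.exists_smul_eq SL(2, ℝ) I z
  exact ⟨f⁻¹ * m, by rw [mul_inv_cancel_left, hm]⟩

theorem offset_smul (γ f : SL(2, ℝ)) (z : ℍ) : offset (γ * f) z = offset f (γ⁻¹ • z) := by
  rw [offset, offset, mul_inv_rev, mul_smul]

theorem neg_smul_eq (γ : SL(2, ℝ)) (z : ℍ) : -γ • z = γ • z := by
  ext
  rw [coe_specialLinearGroup_apply, coe_specialLinearGroup_apply]
  simp
  rw [← neg_add, ← neg_add_rev, add_comm (_ : ℂ) ((γ 1 0 : ℂ) * _), neg_div_neg_eq]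

theorem offset_neg (f : SL(2, ℝ)) (z : ℍ) : offset (-f) z = offset f z := by
  rw [offset, offset, inv_neg, neg_smul_eq]

theorem offset_mul_trans (f : SL(2, ℝ)) (t : ℝ) (z : ℍ) : offset (f * trans t) z = offset f z := by
  obtain ⟨m, rfl⟩ := exists_eq_mul_smul_I (f * trans t) z
  rw [offset_mul_smul_I, mul_assoc f, offset_mul_smul_I, Matrix.SpecialLinearGroup.coe_mul,
    coe_trans]
  have h : Real.exp (t / 2) * Real.exp (-(t / 2)) = 1 := by rw [← Real.exp_add]; simp
  simp [Matrix.mul_apply, Fin.sum_univ_two]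
  linear_combination (-(m 0 0 * m 1 0) - m 0 1 * m 1 1) * h

theorem offset_mul_rot_pi (f : SL(2, ℝ)) (z : ℍ) : offset (f * rot Real.pi) z = -offset f z := by
  obtain ⟨m, rfl⟩ := exists_eq_mul_smul_I (f * rot Real.pi) z
  rw [offset_mul_smul_I, mul_assoc f, offset_mul_smul_I, Matrix.SpecialLinearGroup.coe_mul,
    coe_rot, Real.cos_pi_div_two, Real.sin_pi_div_two]
  simp [Matrix.mul_apply, Fin.sum_univ_two]
  ring

theorem coe_trans_smul_I (t : ℝ) : ((trans t • I : ℍ) : ℂ) = Real.exp t * Complex.I := by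
  have h : Real.exp (t / 2) = Real.exp t * Real.exp (-(t / 2)) := by rw [← Real.exp_add]; ring_nf
  rw [coe_specialLinearGroup_apply, coe_trans]
  have h0 : (Real.exp (-(t / 2)) : ℂ) ≠ 0 := Complex.ofReal_ne_zero.2 (Real.exp_pos _).ne'
  simp only [Algebra.algebraMap_self, RingHom.id_apply, coe_I, Matrix.of_apply, Matrix.cons_val_zero,
    Matrix.cons_val_one, Matrix.cons_val', Matrix.cons_val_fin_one, Complex.ofReal_zero, zero_mul,
    add_zero, zero_add]
  rw [h, Complex.ofReal_mul]
  field_simp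

theorem offset_eq_zero_iff {f : SL(2, ℝ)} {z : ℍ} :
    offset f z = 0 ↔ ∃ d : ℝ, z = (f * trans d) • I := by
  constructor
  · intro h
    have hre : (f⁻¹ • z).re = 0 := by
      rcases div_eq_zero_iff.1 h with h | h
      · exact h
      · exact absurd h (f⁻¹ • z).im_pos.ne'
    refine ⟨Real.log (f⁻¹ • z).im, ?_⟩
    rw [mul_smul, ← inv_smul_eq_iff]
    apply UpperHalfPlane.ext
    rw [coe_trans_smul_I, Real.exp_log (f⁻¹ • z).im_pos]
    apply Complex.ext
    · simpa using hre
    · simp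
  · rintro ⟨d, rfl⟩
    rw [offset_mul_smul_I, coe_trans]
    simp

theorem continuous_offset (f : SL(2, ℝ)) : Continuous (offset f) :=
  (continuous_re.comp (continuous_const_smul _)).div (continuous_im.comp (continuous_const_smul _))
    fun z ↦ (f⁻¹ • z).im_pos.ne'

/-- The offset of a point of the geodesic tangent to `f` from a geodesic in general position. -/
theorem offset_mul_smul_trans {f g m : SL(2, ℝ)} (hm : g * m = 1) (d : ℝ) :
    offset (f * g) ((f * trans d) • I) =
      m 0 0 * m 1 0 * Real.exp d + m 0 1 * m 1 1 * Real.exp (-d) := by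
  have h1 : Real.exp d = Real.exp (d / 2) * Real.exp (d / 2) := by rw [← Real.exp_add]; ring_nf
  have h2 : Real.exp (-d) = Real.exp (-(d / 2)) * Real.exp (-(d / 2)) := by
    rw [← Real.exp_add]; ring_nf
  rw [show f * trans d = f * g * (m * trans d) by rw [mul_assoc, ← mul_assoc g, hm, one_mul],
    offset_mul_smul_I, Matrix.SpecialLinearGroup.coe_mul, coe_trans, h1, h2]
  simp [Matrix.mul_apply, Fin.sum_univ_two]
  ring

theorem coe_leftTurn_inv : ((leftTurn⁻¹ : SL(2, ℝ)) : Matrix (Fin 2) (Fin 2) ℝ) =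
    !![Real.sqrt 2 / 2, -(Real.sqrt 2 / 2); Real.sqrt 2 / 2, Real.sqrt 2 / 2] := by
  rw [Matrix.SpecialLinearGroup.coe_inv, coe_leftTurn, Matrix.adjugate_fin_two_of, neg_neg]

theorem offset_leftTurn (f : SL(2, ℝ)) (d : ℝ) :
    offset (f * leftTurn) ((f * trans d) • I) = Real.sinh d := by
  have h2 : Real.sqrt 2 * Real.sqrt 2 = 2 := Real.mul_self_sqrt (by norm_num)
  rw [offset_mul_smul_trans (mul_inv_cancel leftTurn), coe_leftTurn_inv, Real.sinh_eq]
  simp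
  linear_combination (Real.exp d / 4 - Real.exp (-d) / 4) * h2

theorem offset_crossSeam (R : ℝ) (f : SL(2, ℝ)) (d : ℝ) :
    offset (f * crossSeam R) ((f * trans d) • I) = -(Real.sinh (seamLength R) * Real.cosh d) := by
  rw [offset_mul_smul_trans (mul_inv_cancel _), crossSeam_inv, Matrix.SpecialLinearGroup.coe_neg,
    coe_crossSeam, Real.cosh_eq d, show seamLength R = 2 * (seamLength R / 2) by ring,
    Real.sinh_two_mul, mul_div_cancel_left₀ _ two_ne_zero]
  simp
  ring

theorem offset_hexStep (R : ℝ) (f : SL(2, ℝ)) (d : ℝ) : offset (f * hexStep R) ((f * trans d) • I) =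
    -(Real.sinh (seamLength R) * Real.cosh (d - R / 2)) := by
  rw [← offset_crossSeam R (f * trans (R / 2)), hexStep_eq, mul_assoc f (trans _) (trans _),
    ← trans_add, add_sub_cancel, mul_assoc]

theorem offset_trans_leftTurn (f : SL(2, ℝ)) (x d : ℝ) :
    offset (f * trans x * leftTurn) ((f * trans d) • I) = Real.sinh (d - x) := by
  rw [← offset_leftTurn (f * trans x), mul_assoc f (trans _) (trans _), ← trans_add, add_sub_cancel]

theorem leftTurn_mul_offset (f : SL(2, ℝ)) (d ε : ℝ) :
    offset f ((f * trans d * leftTurn * trans ε) • I) = -Real.sinh ε := by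
  have h2 : Real.sqrt 2 * Real.sqrt 2 = 2 := Real.mul_self_sqrt (by norm_num)
  have h1 : Real.exp ε = Real.exp (ε / 2) * Real.exp (ε / 2) := by rw [← Real.exp_add]; ring_nf
  have h3 : Real.exp (-ε) = Real.exp (-(ε / 2)) * Real.exp (-(ε / 2)) := by
    rw [← Real.exp_add]; ring_nf
  rw [← offset_mul_trans f d, mul_assoc (f * trans d), offset_mul_smul_I,
    Matrix.SpecialLinearGroup.coe_mul, coe_leftTurn, coe_trans, Real.sinh_eq, h1, h3]
  simp [Matrix.mul_apply, Fin.sum_univ_two]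
  linear_combination (-(Real.exp (ε / 2) * Real.exp (ε / 2)) / 4 +
    Real.exp (-(ε / 2)) * Real.exp (-(ε / 2)) / 4) * h2

/-- The opposite side of the hexagon is the seam that starts at `f * hexStep R * trans (R / 2)`. -/
theorem offset_oppositeSeam {R : ℝ} (hR : 0 < R) (f : SL(2, ℝ)) (d : ℝ) :
    offset (f * hexStep R * trans (R / 2) * leftTurn) ((f * trans d) • I) =
      -(Real.cosh (R / 2) / Real.sinh (R / 4) * Real.cosh (d - R / 4)) := by
  have hinv : hexStep R * trans (R / 2) * leftTurn *
      -(leftTurn⁻¹ * (crossSeam R * trans (R / 2) * crossSeam R)) = 1 := by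
    have h3 := hexStep_zpow_three hR
    rw [show (3 : ℤ) = 1 + 1 + 1 by rfl, zpow_add, zpow_add, zpow_one] at h3
    simp only [hexStep_eq, mul_assoc, mul_neg] at h3 ⊢
    rw [mul_inv_cancel_left, h3, neg_neg]
  have hs : 0 < Real.sinh (R / 4) := Real.sinh_pos_iff.2 (by linarith)
  have hC := Real.cosh_sq (seamLength R / 2)
  have hS : Real.sinh (seamLength R / 2) * (Real.exp (R / 4) - Real.exp (-(R / 4))) = 1 := by
    rw [sinh_half_seamLength, show Real.exp (R / 4) - Real.exp (-(R / 4)) = 2 * Real.sinh (R / 4) by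
      rw [Real.sinh_eq]; ring]
    field_simp
  have hee : Real.exp (R / 4) * Real.exp (-(R / 4)) = 1 := by rw [← Real.exp_add]; simp
  have h2 : Real.sqrt 2 * Real.sqrt 2 = 2 := Real.mul_self_sqrt (by norm_num)
  have hR2 : Real.cosh (R / 2) = (Real.exp (R / 4) ^ 2 + Real.exp (-(R / 4)) ^ 2) / 2 := by
    rw [Real.cosh_eq, ← Real.exp_nat_mul, ← Real.exp_nat_mul]; push_cast; ring_nf
  have hd : Real.cosh (d - R / 4) =
      (Real.exp d * Real.exp (-(R / 4)) + Real.exp (-d) * Real.exp (R / 4)) / 2 := by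
    rw [Real.cosh_eq, ← Real.exp_add, ← Real.exp_add]; ring_nf
  have hdiv : Real.cosh (R / 2) / Real.sinh (R / 4) =
      2 * Real.sinh (seamLength R / 2) * Real.cosh (R / 2) := by
    rw [sinh_half_seamLength]; field_simp
  rw [mul_assoc f (hexStep R), mul_assoc f, offset_mul_smul_trans hinv, hdiv, hR2, hd]
  simp only [Matrix.SpecialLinearGroup.coe_neg, Matrix.SpecialLinearGroup.coe_mul, coe_crossSeam,
    coe_leftTurn_inv, coe_trans, show R / 2 / 2 = R / 4 by ring]
  generalize Real.sinh (seamLength R / 2) = S at *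
  generalize Real.cosh (seamLength R / 2) = C at *
  generalize Real.exp (R / 4) = e at *
  generalize Real.exp (-(R / 4)) = e' at *
  generalize Real.sqrt 2 = q at *
  have k1 : C ^ 2 * e' ^ 2 - e ^ 2 * S ^ 2 = -(S * (e ^ 2 + e' ^ 2) * e') := by
    linear_combination e' ^ 2 * hC - S * (e + e') * hS - e' ^ 2 * hS + (S * e + S * e') * hee
  have k2 : S ^ 2 * e' ^ 2 - e ^ 2 * C ^ 2 = -(S * (e ^ 2 + e' ^ 2) * e) := by
    linear_combination -e ^ 2 * hC - S * (e + e') * hS + e ^ 2 * hS + (S * e + S * e') * hee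
  simp
  linear_combination (Real.exp d * (C ^ 2 - S ^ 2) * (C ^ 2 * e' ^ 2 - e ^ 2 * S ^ 2) / 4 +
    Real.exp (-d) * (C ^ 2 - S ^ 2) * (S ^ 2 * e' ^ 2 - e ^ 2 * C ^ 2) / 4) * h2 +
    (Real.exp d / 2) * k1 + (Real.exp (-d) / 2) * k2 +
    (Real.exp d * (C ^ 2 * e' ^ 2 - e ^ 2 * S ^ 2) / 2 +
      Real.exp (-d) * (S ^ 2 * e' ^ 2 - e ^ 2 * C ^ 2) / 2) * hC

/-! ### Hexagons -/

theorem leftTurn_mul_leftTurn : leftTurn * leftTurn = rot Real.pi := by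
  have h2 : Real.sqrt 2 * Real.sqrt 2 = 2 := Real.mul_self_sqrt (by norm_num)
  ext i j
  rw [Matrix.SpecialLinearGroup.coe_mul, coe_leftTurn, coe_rot, Real.cos_pi_div_two,
    Real.sin_pi_div_two]
  fin_cases i <;> fin_cases j <;> simp [Matrix.mul_apply, Fin.sum_univ_two] <;> linarith

theorem crossSeam_mul_leftTurn (R : ℝ) :
    crossSeam R * leftTurn = leftTurn * trans (seamLength R) * rot Real.pi := by
  rw [crossSeam, mul_assoc, leftTurn_mul_leftTurn]

theorem hexStep_sq {R : ℝ} (hR : 0 < R) :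
    hexStep R * hexStep R = crossSeam R * trans (-(R / 2)) := by
  have h3 := hexStep_pow_three hR
  rw [pow_succ, pow_two, ← eq_mul_inv_iff_mul_eq] at h3
  rw [h3, hexStep_eq, mul_inv_rev, crossSeam_inv, trans_neg]
  simp

theorem hexStep_mul_crossSeam (R : ℝ) : hexStep R * crossSeam R = -trans (R / 2) := by
  rw [hexStep_eq, mul_assoc, crossSeam_mul_crossSeam, mul_neg, mul_one]

theorem offset_crossSeam_leftTurn (R : ℝ) (f : SL(2, ℝ)) (z : ℍ) :
    offset (f * crossSeam R * leftTurn) z = -offset (f * leftTurn) z := by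
  rw [mul_assoc, crossSeam_mul_leftTurn, ← mul_assoc, ← mul_assoc, offset_mul_rot_pi,
    offset_mul_trans]

theorem offset_hexStep_sq {R : ℝ} (hR : 0 < R) (f : SL(2, ℝ)) (z : ℍ) :
    offset (f * hexStep R * hexStep R) z = offset (f * crossSeam R) z := by
  rw [mul_assoc, hexStep_sq hR, ← mul_assoc, offset_mul_trans]

theorem offset_hexStep_crossSeam (R : ℝ) (f : SL(2, ℝ)) (z : ℍ) :
    offset (f * hexStep R * crossSeam R) z = offset f z := by
  rw [mul_assoc, hexStep_mul_crossSeam, mul_neg, offset_neg, offset_mul_trans]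

theorem offset_hexStep_sq_seam {R : ℝ} (hR : 0 < R) (f : SL(2, ℝ)) (z : ℍ) :
    offset (f * hexStep R * hexStep R * trans (R / 2) * leftTurn) z =
      -offset (f * leftTurn) z := by
  rw [mul_assoc f, hexStep_sq hR, ← mul_assoc, mul_assoc _ (trans _) (trans _), ← trans_add,
    neg_add_cancel, trans_zero, mul_one, offset_crossSeam_leftTurn]

theorem offset_hexStep_leftTurn (R : ℝ) (f : SL(2, ℝ)) (z : ℍ) :
    offset (f * hexStep R * leftTurn) z = -offset (f * trans (R / 2) * leftTurn) z := by
  rw [hexStep_eq, ← mul_assoc, offset_crossSeam_leftTurn]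

/-- The open hexagon, cut out by the strict inequalities of the six sides. -/
def openHexagon (R : ℝ) (f : SL(2, ℝ)) : Set ℍ :=
  {z | offset f z < 0 ∧ offset (f * hexStep R) z < 0 ∧ offset (f * crossSeam R) z < 0 ∧
    offset (f * trans (R / 2) * leftTurn) z < 0 ∧
    offset (f * hexStep R * trans (R / 2) * leftTurn) z < 0 ∧ 0 < offset (f * leftTurn) z}

theorem isOpen_openHexagon (R : ℝ) (f : SL(2, ℝ)) : IsOpen (openHexagon R f) := by
  have h : ∀ g : SL(2, ℝ), IsOpen {z | offset g z < 0} := fun g ↦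
    isOpen_lt (continuous_offset g) continuous_const
  exact (h _).inter <| (h _).inter <| (h _).inter <| (h _).inter <| (h _).inter <|
    isOpen_lt continuous_const (continuous_offset _)

theorem mem_leftHalfPlane {f : SL(2, ℝ)} {z : ℍ} (h : offset f z < 0) : z ∈ leftHalfPlane f := by
  by_contra! h'
  exact h.not_ge (div_nonneg (not_le.1 h').le (f⁻¹ • z).im_pos.le)

theorem openHexagon_subset_interior {R : ℝ} (hR : 0 < R) (f : SL(2, ℝ)) :
    openHexagon R f ⊆ interior (hexagon R f) := by
  refine interior_maximal (fun z hz ↦ ?_) (isOpen_openHexagon R f)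
  obtain ⟨h1, h2, h3, h4, h5, h6⟩ := hz
  refine Set.mem_iInter.2 fun i ↦ ⟨mem_leftHalfPlane ?_, mem_leftHalfPlane ?_⟩
  · fin_cases i
    · simpa [cuffFrame] using h1
    · simpa [cuffFrame] using h2
    · simpa [cuffFrame, pow_two, ← mul_assoc, offset_hexStep_sq hR] using h3
  · rw [seamFrame, ← leftTurn, cuffFrame]
    fin_cases i
    · simpa using h4
    · simpa using h5
    · simpa [pow_two, ← mul_assoc, offset_hexStep_sq_seam hR] using h6

theorem openHexagon_mul_hexStep {R : ℝ} (hR : 0 < R) (f : SL(2, ℝ)) :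
    openHexagon R (f * hexStep R) = openHexagon R f := by
  ext z
  simp only [openHexagon, Set.mem_ofPred_eq, offset_hexStep_sq hR, offset_hexStep_crossSeam,
    offset_hexStep_sq_seam hR, offset_hexStep_leftTurn, Left.neg_neg_iff, Left.neg_pos_iff]
  constructor
  · rintro ⟨h1, h2, h3, h4, h5, h6⟩
    exact ⟨h3, h1, h2, h6, h4, h5⟩
  · rintro ⟨h1, h2, h3, h4, h5, h6⟩
    exact ⟨h2, h3, h1, h5, h6, h4⟩

theorem openHexagon_mul_hexStep_zpow {R : ℝ} (hR : 0 < R) (f : SL(2, ℝ)) (k : ℤ) :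
    openHexagon R (f * hexStep R ^ k) = openHexagon R f := by
  induction k with
  | zero => simp
  | succ n ih => rw [zpow_add_one, ← mul_assoc, openHexagon_mul_hexStep hR, ih]
  | pred n ih =>
    rw [← ih, ← openHexagon_mul_hexStep hR, mul_assoc, ← zpow_add_one, sub_add_cancel]

theorem mem_openHexagon_mul {R : ℝ} {γ f : SL(2, ℝ)} {z : ℍ} :
    z ∈ openHexagon R (γ * f) ↔ γ⁻¹ • z ∈ openHexagon R f := by
  simp only [openHexagon, Set.mem_ofPred_eq, mul_assoc, offset_smul γ]

/-- The interior of the union of two hexagons that are adjacent along the seam at `f`, including the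
interior of this seam. -/
def seamNeighborhood (R : ℝ) (f : SL(2, ℝ)) : Set ℍ :=
  {z | offset f z < 0 ∧ offset (f * crossSeam R) z < 0 ∧ offset (f * hexStep R) z < 0 ∧
    offset (f * trans (-(R / 2)) * crossSeam R) z < 0 ∧
    offset (f * trans (R / 2) * leftTurn) z < 0 ∧
    0 < offset (f * trans (-(R / 2)) * leftTurn) z ∧
    offset (f * hexStep R * trans (R / 2) * leftTurn) z < 0 ∧
    offset (f * trans (-(R / 2)) * hexStep R * trans (R / 2) * leftTurn) z < 0}

theorem isOpen_seamNeighborhood (R : ℝ) (f : SL(2, ℝ)) : IsOpen (seamNeighborhood R f) := by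
  have h : ∀ g : SL(2, ℝ), IsOpen {z | offset g z < 0} := fun g ↦
    isOpen_lt (continuous_offset g) continuous_const
  exact (h _).inter <| (h _).inter <| (h _).inter <| (h _).inter <| (h _).inter <|
    (isOpen_lt continuous_const (continuous_offset _)).inter <| (h _).inter (h _)

theorem trans_neg_mul_hexStep (R : ℝ) (f : SL(2, ℝ)) :
    f * trans (-(R / 2)) * hexStep R = f * crossSeam R := by
  rw [hexStep_eq, mul_assoc, ← mul_assoc (trans _), ← trans_add, neg_add_cancel, trans_zero, one_mul]

theorem mem_openHexagon_of_offset_pos {R : ℝ} {f : SL(2, ℝ)} {z : ℍ}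
    (hz : z ∈ seamNeighborhood R f) (h : 0 < offset (f * leftTurn) z) : z ∈ openHexagon R f := by
  obtain ⟨h1, h2, h3, h4, h5, h6, h7, h8⟩ := hz
  exact ⟨h1, h3, h2, h5, h7, h⟩

theorem mem_openHexagon_of_offset_neg {R : ℝ} {f : SL(2, ℝ)} {z : ℍ}
    (hz : z ∈ seamNeighborhood R f) (h : offset (f * leftTurn) z < 0) :
    z ∈ openHexagon R (f * trans (-(R / 2))) := by
  obtain ⟨h1, h2, h3, h4, h5, h6, h7, h8⟩ := hz
  have hback : f * trans (-(R / 2)) * trans (R / 2) = f := by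
    rw [mul_assoc, ← trans_add, neg_add_cancel, trans_zero, mul_one]
  refine ⟨?_, ?_, h4, ?_, h8, h6⟩
  · rw [offset_mul_trans]; exact h1
  · rw [trans_neg_mul_hexStep]; exact h2
  · rw [hback]; exact h

theorem offset_hexStep_zpow {R : ℝ} (hR : 0 < R) (f : SL(2, ℝ)) (k : ℤ) (z : ℍ) :
    offset (f * hexStep R ^ k) z = offset f z ∨
      offset (f * hexStep R ^ k) z = offset (f * hexStep R) z ∨
      offset (f * hexStep R ^ k) z = offset (f * crossSeam R) z := by
  have h3 : ∀ (n : ℤ) (g : SL(2, ℝ)), offset (g * hexStep R ^ (3 * n)) z = offset g z := by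
    intro n g
    rw [zpow_mul, hexStep_zpow_three hR]
    rcases Int.even_or_odd n with h | h
    · rw [h.neg_one_zpow, mul_one]
    · rw [h.neg_one_zpow, mul_neg, mul_one, offset_neg]
  have hk : f * hexStep R ^ k = f * hexStep R ^ (k % 3) * hexStep R ^ (3 * (k / 3)) := by
    rw [mul_assoc, ← zpow_add, Int.emod_add_mul_ediv]
  rw [hk, h3]
  have : k % 3 = 0 ∨ k % 3 = 1 ∨ k % 3 = 2 := by omega
  rcases this with h | h | h
  · left; simp [h]
  · right; left; simp [h]
  · right; right; rw [h, ← offset_hexStep_sq hR, zpow_two, mul_assoc]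

/-! ### Perturbation of points of geodesics -/

theorem continuous_smul_trans (f : SL(2, ℝ)) : Continuous fun t ↦ (f * trans t) • I := by
  have h : Continuous fun t ↦ trans t • I := by
    rw [UpperHalfPlane.isEmbedding_coe.continuous_iff]
    have : ((↑) ∘ fun t ↦ trans t • I : ℝ → ℂ) = fun t ↦ Real.exp t * Complex.I := by
      ext t; exact coe_trans_smul_I t
    rw [this]
    fun_prop
  simp only [mul_smul]
  exact h.const_smul f

theorem rot_smul_I (θ : ℝ) : rot θ • I = I := by
  have hne : (-Real.sin (θ / 2) : ℂ) * Complex.I + Real.cos (θ / 2) ≠ 0 := by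
    intro h
    have h1 := congrArg Complex.re h
    have h2 := congrArg Complex.im h
    simp only [Complex.add_re, Complex.add_im, Complex.mul_re, Complex.mul_im, Complex.neg_re,
      Complex.neg_im, Complex.ofReal_re, Complex.ofReal_im, Complex.I_re, Complex.I_im,
      Complex.zero_re, Complex.zero_im] at h1 h2
    nlinarith [Real.sin_sq_add_cos_sq (θ / 2)]
  apply UpperHalfPlane.ext
  rw [coe_specialLinearGroup_apply, coe_rot]
  simp only [Algebra.algebraMap_self, RingHom.id_apply, coe_I, Matrix.of_apply, Matrix.cons_val_zero,
    Matrix.cons_val_one, Matrix.cons_val', Matrix.cons_val_fin_one, Complex.ofReal_neg]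
  rw [div_eq_iff hne]
  linear_combination (Real.sin (θ / 2) : ℂ) * Complex.I_sq

open Topology in
theorem exists_mem_offset_neg {f : SL(2, ℝ)} {z : ℍ} (hz : offset f z = 0) {U : Set ℍ}
    (hU : IsOpen U) (hzU : z ∈ U) : ∃ w ∈ U, offset f w < 0 := by
  obtain ⟨d, rfl⟩ := offset_eq_zero_iff.1 hz
  have hV : IsOpen ((fun t ↦ (f * trans d * leftTurn * trans t) • I) ⁻¹' U) :=
    hU.preimage (continuous_smul_trans _)
  have h0 : (0 : ℝ) ∈ (fun t ↦ (f * trans d * leftTurn * trans t) • I) ⁻¹' U := by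
    rwa [Set.mem_preimage, trans_zero, mul_one, mul_smul _ leftTurn, leftTurn, rot_smul_I]
  obtain ⟨ε, hε, hpos⟩ :=
    Filter.nonempty_of_mem (f := 𝓝[>] (0 : ℝ))
      (Filter.inter_mem (nhdsWithin_le_nhds (hV.mem_nhds h0)) self_mem_nhdsWithin)
  refine ⟨_, hε, ?_⟩
  rw [leftTurn_mul_offset]
  exact neg_neg_of_pos (Real.sinh_pos_iff.2 hpos)

theorem sinh_seamLength_pos {R : ℝ} (hR : 0 < R) : 0 < Real.sinh (seamLength R) := by
  have hs : 0 < Real.sinh (R / 4) := Real.sinh_pos_iff.2 (by linarith)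
  rw [Real.sinh_pos_iff, seamLength]
  have := Real.arsinh_pos_iff.2 (show 0 < 1 / (2 * Real.sinh (R / 4)) by positivity)
  linarith

theorem oppositeSeam_neg {R : ℝ} (hR : 0 < R) (f : SL(2, ℝ)) (d : ℝ) :
    offset (f * hexStep R * trans (R / 2) * leftTurn) ((f * trans d) • I) < 0 := by
  have hs : 0 < Real.sinh (R / 4) := Real.sinh_pos_iff.2 (by linarith)
  rw [offset_oppositeSeam hR, neg_lt_zero]
  have := Real.cosh_pos (R / 2)
  have := Real.cosh_pos (d - R / 4)
  positivity

/-- The `R / 2`-translates of the hexagon along a side accumulate at every point of the line through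
this side. -/
theorem exists_accumulating_openHexagon {R : ℝ} (hR : 0 < R) {f : SL(2, ℝ)} {z : ℍ}
    (hz : offset f z = 0) : ∃ n : ℤ, ∀ U : Set ℍ, IsOpen U → z ∈ U →
      (U ∩ openHexagon R (f * trans (n * (R / 2)))).Nonempty := by
  obtain ⟨d, rfl⟩ := offset_eq_zero_iff.1 hz
  refine ⟨⌊d / (R / 2)⌋, fun U hU hzU ↦ ?_⟩
  have hx0 : 0 ≤ d - ⌊d / (R / 2)⌋ * (R / 2) := by
    have := Int.floor_le (d / (R / 2))
    rw [le_div_iff₀ (by linarith)] at this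
    linarith
  have hx1 : d - ⌊d / (R / 2)⌋ * (R / 2) < R / 2 := by
    have := Int.lt_floor_add_one (d / (R / 2))
    rw [div_lt_iff₀ (by linarith)] at this
    linarith
  set e := f * trans (⌊d / (R / 2)⌋ * (R / 2)) with he
  set x := d - ⌊d / (R / 2)⌋ * (R / 2)
  have hfe : f * trans d = e * trans x := by
    rw [he, mul_assoc, ← trans_add, add_sub_cancel]
  rw [hfe] at hzU
  have hV : IsOpen ((fun t ↦ (e * trans t) • I) ⁻¹' U) := hU.preimage (continuous_smul_trans _)
  obtain ⟨y, hyU, hy⟩ := Filter.nonempty_of_mem (f := nhdsWithin x (Set.Ioi x))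
    (Filter.inter_mem (nhdsWithin_le_nhds (hV.mem_nhds hzU)) (Ioo_mem_nhdsGT hx1))
  have hs := sinh_seamLength_pos hR
  have hneg : ∀ g : SL(2, ℝ), IsOpen {z | offset g z < 0} := fun g ↦
    isOpen_lt (continuous_offset g) continuous_const
  obtain ⟨w, ⟨hwU, h2, h3, h4, h5, h6⟩, h1⟩ := exists_mem_offset_neg (f := e)
    (z := (e * trans y) • I) (offset_eq_zero_iff.2 ⟨y, rfl⟩)
    (hU.inter <| (hneg (e * hexStep R)).inter <| (hneg (e * crossSeam R)).inter <|
      (hneg (e * trans (R / 2) * leftTurn)).inter <|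
      (hneg (e * hexStep R * trans (R / 2) * leftTurn)).inter <|
      isOpen_lt continuous_const (continuous_offset (e * leftTurn)))
    ⟨hyU, by
      rw [Set.mem_ofPred_eq, offset_hexStep]
      have := Real.cosh_pos (y - R / 2)
      exact neg_neg_of_pos (by positivity), by
      rw [Set.mem_ofPred_eq, offset_crossSeam]
      have := Real.cosh_pos y
      exact neg_neg_of_pos (by positivity), by
      rw [Set.mem_ofPred_eq, offset_trans_leftTurn, Real.sinh_neg_iff]
      linarith [hy.2], oppositeSeam_neg hR e y, by
      rw [Set.mem_ofPred_eq, offset_leftTurn, Real.sinh_pos_iff]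
      linarith [hy.1]⟩
  exact ⟨w, hwU, h1, h2, h3, h4, h5, h6⟩

/-! ### Offsets along a geodesic -/

theorem exists_offset_smul_trans (f h : SL(2, ℝ)) : ∃ a b : ℝ, -1 ≤ 4 * (a * b) ∧ ∀ t,
    offset f ((h * trans t) • I) = a * Real.exp t + b * Real.exp (-t) := by
  set m := f⁻¹ * h with hm
  have hdet : m 0 0 * m 1 1 - m 0 1 * m 1 0 = 1 := by rw [← Matrix.det_fin_two]; exact m.2
  refine ⟨m 0 0 * m 1 0, m 0 1 * m 1 1, ?_, fun t ↦ ?_⟩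
  · have : m 0 0 * m 1 1 = 1 + m 0 1 * m 1 0 := by linarith
    rw [show m 0 0 * m 1 0 * (m 0 1 * m 1 1) = m 0 0 * m 1 1 * (m 0 1 * m 1 0) by ring, this]
    nlinarith [sq_nonneg (2 * (m 0 1 * m 1 0) + 1)]
  · rw [← offset_mul_smul_trans (f := h) (g := h⁻¹ * f) (m := m) (by rw [hm]; group),
      mul_inv_cancel_left]

theorem offset_add_bounds (f h : SL(2, ℝ)) (t : ℝ) {τ D : ℝ} (hτ : 0 ≤ τ)
    (hD : offset f ((h * trans t) • I) = Real.sinh D) :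
    Real.sinh (D - τ) ≤ offset f ((h * trans (t + τ)) • I) ∧
      offset f ((h * trans (t + τ)) • I) ≤ Real.sinh (D + τ) := by
  obtain ⟨a, b, hab, hfun⟩ := exists_offset_smul_trans f (h * trans t)
  have h0 := hfun 0
  rw [trans_zero, mul_one, hD] at h0
  rw [trans_add, ← mul_assoc, hfun, Real.sinh_add, Real.sinh_sub]
  simp only [neg_zero, Real.exp_zero, mul_one] at h0
  have hab2 : (a - b) ^ 2 ≤ Real.cosh D ^ 2 := by rw [Real.cosh_sq, h0]; nlinarith
  obtain ⟨h1, h2⟩ := abs_le_of_sq_le_sq' hab2 (Real.cosh_pos D).le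
  have hsh : 0 ≤ Real.sinh τ := Real.sinh_nonneg_iff.2 hτ
  have he : a * Real.exp τ + b * Real.exp (-τ) =
      Real.sinh D * Real.cosh τ + (a - b) * Real.sinh τ := by
    rw [h0, Real.cosh_eq, Real.sinh_eq]; ring
  rw [he]
  constructor <;> nlinarith

/-- A geodesic that is not contained in a given geodesic and meets it stays on one side of it
afterwards. -/
theorem offset_sign_after {f h : SL(2, ℝ)} {t₀ t : ℝ} (h₀ : offset f ((h * trans t₀) • I) ≠ 0)
    (ht : offset f ((h * trans t) • I) = 0) :
    (∀ τ, t < τ → offset f ((h * trans τ) • I) < 0) ∧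
        (∀ τ, τ < t → 0 < offset f ((h * trans τ) • I)) ∨
      (∀ τ, t < τ → 0 < offset f ((h * trans τ) • I)) ∧
        (∀ τ, τ < t → offset f ((h * trans τ) • I) < 0) := by
  obtain ⟨a, b, -, hfun⟩ := exists_offset_smul_trans f (h * trans t)
  have hG : ∀ τ, offset f ((h * trans τ) • I) = a * (Real.exp (τ - t) - Real.exp (-(τ - t))) := by
    have h0 := hfun 0
    rw [trans_zero, mul_one, ht] at h0
    simp only [neg_zero, Real.exp_zero, mul_one] at h0
    intro τ
    have := hfun (τ - t)
    rw [mul_assoc h, ← trans_add, add_sub_cancel] at this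
    rw [this, show b = -a by linarith]; ring
  have ha : a ≠ 0 := by
    rintro rfl
    exact h₀ (by rw [hG, zero_mul])
  have hp : ∀ τ, t < τ → 0 < Real.exp (τ - t) - Real.exp (-(τ - t)) := fun τ h ↦
    sub_pos.2 (Real.exp_lt_exp.2 (by linarith))
  have hn : ∀ τ, τ < t → Real.exp (τ - t) - Real.exp (-(τ - t)) < 0 := fun τ h ↦
    sub_neg.2 (Real.exp_lt_exp.2 (by linarith))
  rcases ha.lt_or_gt with ha | ha
  · exact Or.inl ⟨fun τ h ↦ by rw [hG]; exact mul_neg_of_neg_of_pos ha (hp τ h),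
      fun τ h ↦ by rw [hG]; exact mul_pos_of_neg_of_neg ha (hn τ h)⟩
  · exact Or.inr ⟨fun τ h ↦ by rw [hG]; exact mul_pos ha (hp τ h),
      fun τ h ↦ by rw [hG]; exact mul_neg_of_pos_of_neg ha (hn τ h)⟩

namespace SurfaceOfType

variable {R : ℝ} (S : SurfaceOfType R)

/-! ### The frames along the sides of the lifted hexagons -/

/-- The lift to `ℍ` of a frame tangent to a cuff at a foot of a seam, with the pants on its left. -/
def IsSideFrame (f : SL(2, ℝ)) : Prop :=
  ∃ γ ∈ S.Γ, ∃ (p : S.Pants) (k n : ℤ), f = γ * (S.frame p * hexStep R ^ k * trans (n * (R / 2)))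

/-- The frame from which each of the two hexagons of a pair of pants starts. -/
noncomputable def hexagonFrame (p : S.Pants) : Bool → SL(2, ℝ)
  | false => S.frame p
  | true => S.frame p * trans (R / 2)

theorem neg_mem {γ : SL(2, ℝ)} (h : γ ∈ S.Γ) : -γ ∈ S.Γ := by
  rw [← neg_one_mul]
  exact S.Γ.mul_mem S.isSurfaceGroup.neg_one_mem h

theorem exists_cuffFrame (hR : 0 < R) (p : S.Pants) (k : ℤ) : ∃ i : Fin 3,
    S.frame p * hexStep R ^ k = cuffFrame R (S.frame p) i ∨
      S.frame p * hexStep R ^ k = -cuffFrame R (S.frame p) i := by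
  have h3 : hexStep R ^ (3 * (k / 3)) = 1 ∨ hexStep R ^ (3 * (k / 3)) = -1 := by
    rw [zpow_mul, hexStep_zpow_three hR]
    rcases Int.even_or_odd (k / 3) with h | h
    · exact Or.inl h.neg_one_zpow
    · exact Or.inr h.neg_one_zpow
  have hlt : (k % 3).toNat < 3 := by omega
  have hk : hexStep R ^ k = hexStep R ^ (k % 3).toNat * hexStep R ^ (3 * (k / 3)) := by
    rw [← zpow_natCast, ← zpow_add]
    congr 1
    omega
  refine ⟨⟨(k % 3).toNat, hlt⟩, ?_⟩
  rw [hk, cuffFrame]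
  rcases h3 with h | h <;> rw [h] <;> simp

theorem boundary_zpow_mem (hR : 0 < R) (p : S.Pants) (k m : ℤ) :
    S.frame p * hexStep R ^ k * trans (m * R) * (S.frame p * hexStep R ^ k)⁻¹ ∈ S.Γ := by
  rw [← trans_zpow, ← conj_zpow]
  refine S.Γ.zpow_mem ?_ m
  obtain ⟨i, h | h⟩ := S.exists_cuffFrame hR p k <;> rw [h]
  · exact S.boundary_mem p i
  · simpa using S.boundary_mem p i

theorem exists_mul_trans (hR : 0 < R) (p : S.Pants) (k m : ℤ) : ∃ γ ∈ S.Γ,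
    S.frame p * hexStep R ^ k * trans (m * R) = γ * (S.frame p * hexStep R ^ k) :=
  ⟨_, S.boundary_zpow_mem hR p k m, by rw [inv_mul_cancel_right]⟩

theorem exists_mul_trans_mul_hexStep (hR : 0 < R) (p : S.Pants) (k : ℤ) : ∃ γ ∈ S.Γ,
    S.frame p * hexStep R ^ k * trans (R / 2) * hexStep R =
      γ * (S.frame p * hexStep R ^ (k - 1) * trans (R / 2)) := by
  obtain ⟨γ, hγ, h⟩ := S.exists_mul_trans hR p k 1
  refine ⟨-γ, S.neg_mem hγ, ?_⟩
  have hk : hexStep R ^ k = hexStep R ^ (k - 1) * hexStep R := by rw [← zpow_add_one]; simp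
  calc S.frame p * hexStep R ^ k * trans (R / 2) * hexStep R
      = S.frame p * hexStep R ^ k * trans ((1 : ℤ) * R) * crossSeam R := by
        rw [hexStep_eq, ← mul_assoc, mul_assoc _ (trans _) (trans _), ← trans_add]
        push_cast; ring_nf
    _ = γ * (S.frame p * hexStep R ^ (k - 1) * (hexStep R * crossSeam R)) := by
        rw [h, hk]; simp only [mul_assoc]
    _ = _ := by rw [hexStep_mul_crossSeam]; simp

variable {S}

theorem IsSideFrame.smul {f γ : SL(2, ℝ)} (hf : S.IsSideFrame f) (hγ : γ ∈ S.Γ) :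
    S.IsSideFrame (γ * f) := by
  obtain ⟨γ', hγ', p, k, n, rfl⟩ := hf
  exact ⟨γ * γ', S.Γ.mul_mem hγ hγ', p, k, n, (mul_assoc _ _ _).symm⟩

theorem IsSideFrame.mul_trans {f : SL(2, ℝ)} (hf : S.IsSideFrame f) (n : ℤ) :
    S.IsSideFrame (f * trans (n * (R / 2))) := by
  obtain ⟨γ, hγ, p, k, m, rfl⟩ := hf
  refine ⟨γ, hγ, p, k, m + n, ?_⟩
  rw [mul_assoc γ, mul_assoc _ (trans _) (trans _), ← trans_add]
  push_cast; ring_nf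

/-- A side frame is equivalent to a side of one of the two hexagons of a pair of pants. -/
theorem IsSideFrame.reduce (hR : 0 < R) {f : SL(2, ℝ)} (hf : S.IsSideFrame f) :
    ∃ γ ∈ S.Γ, ∃ (p : S.Pants) (k : ℤ), f = γ * (S.frame p * hexStep R ^ k) ∨
      f = γ * (S.frame p * hexStep R ^ k * trans (R / 2)) := by
  obtain ⟨γ, hγ, p, k, n, rfl⟩ := hf
  obtain ⟨m, rfl | rfl⟩ := Int.even_or_odd' n <;> obtain ⟨γ', hγ', h⟩ := S.exists_mul_trans hR p k m
  · refine ⟨γ * γ', S.Γ.mul_mem hγ hγ', p, k, Or.inl ?_⟩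
    rw [mul_assoc γ, ← h]
    push_cast; ring_nf
  · refine ⟨γ * γ', S.Γ.mul_mem hγ hγ', p, k, Or.inr ?_⟩
    rw [mul_assoc γ, ← mul_assoc γ', ← h, mul_assoc _ (trans _) (trans _), ← trans_add]
    push_cast; ring_nf

theorem IsSideFrame.mul_hexStep (hR : 0 < R) {f : SL(2, ℝ)} (hf : S.IsSideFrame f) :
    S.IsSideFrame (f * hexStep R) := by
  obtain ⟨γ, hγ, p, k, rfl | rfl⟩ := hf.reduce hR
  · exact ⟨γ, hγ, p, k + 1, 0, by simp [zpow_add_one, mul_assoc, trans_zero]⟩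
  · obtain ⟨γ', hγ', h⟩ := S.exists_mul_trans_mul_hexStep hR p k
    exact ⟨γ * γ', S.Γ.mul_mem hγ hγ', p, k - 1, 1, by rw [mul_assoc γ, h]; simp [mul_assoc]⟩

theorem IsSideFrame.mul_crossSeam (hR : 0 < R) {f : SL(2, ℝ)} (hf : S.IsSideFrame f) :
    S.IsSideFrame (f * crossSeam R) := by
  have h := (hf.mul_trans (-1)).mul_hexStep hR
  rwa [hexStep_eq, ← mul_assoc, mul_assoc f, ← trans_add, show ((-1 : ℤ) : ℝ) * (R / 2) + R / 2 = 0 by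
    push_cast; ring, trans_zero, mul_one] at h

/-- Each side frame is opposite to the side frame that is shifted by the shear parameter `1`. -/
theorem IsSideFrame.mul_trans_one_mul_rot_pi (hR : 0 < R) {f : SL(2, ℝ)} (hf : S.IsSideFrame f) :
    S.IsSideFrame (f * trans 1 * rot Real.pi) := by
  obtain ⟨γ, hγ, p, k, n, rfl⟩ := hf
  obtain ⟨i, hi⟩ := S.exists_cuffFrame hR p k
  obtain ⟨γ', hγ', m, h⟩ := S.shear_eq_one (p, i)
  have hside : S.IsSideFrame
      (γ * γ' * (cuffFrame R (S.frame (S.glue (p, i)).1) (S.glue (p, i)).2 *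
        trans ((m - n : ℤ) * (R / 2)))) :=
    ⟨γ * γ', S.Γ.mul_mem hγ hγ', _, ((S.glue (p, i)).2 : ℕ), m - n, by rw [zpow_natCast, cuffFrame]⟩
  have key : cuffFrame R (S.frame p) i * trans (n * (R / 2)) * trans 1 * rot Real.pi =
      γ' * (cuffFrame R (S.frame (S.glue (p, i)).1) (S.glue (p, i)).2 *
        trans ((m - n : ℤ) * (R / 2))) := by
    rw [← mul_assoc γ', h, mul_assoc _ (rot _) (trans _), rot_pi_mul_trans, ← mul_assoc _ (trans _),
      mul_assoc _ (trans _) (trans _), mul_assoc _ (trans _) (trans _), ← trans_add, ← trans_add]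
    push_cast; ring_nf
  rcases hi with hi | hi <;> rw [hi]
  · convert hside using 1
    rw [mul_assoc γ γ', ← key]; simp only [mul_assoc]
  · convert hside.smul S.isSurfaceGroup.neg_one_mem using 1
    rw [mul_assoc γ γ', ← key]; simp only [mul_assoc, neg_mul, one_mul, mul_neg]

theorem IsSideFrame.exists_hexagonFrame (hR : 0 < R) {f : SL(2, ℝ)} (hf : S.IsSideFrame f) :
    ∃ γ ∈ S.Γ, ∃ (p : S.Pants) (b : Bool) (k : ℤ), f = γ * S.hexagonFrame p b * hexStep R ^ k := by
  obtain ⟨γ, hγ, p, k, rfl | rfl⟩ := hf.reduce hR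
  · exact ⟨γ, hγ, p, false, k, by rw [hexagonFrame, mul_assoc]⟩
  · suffices h : ∃ γ' ∈ S.Γ, ∃ j : ℤ, S.frame p * hexStep R ^ k * trans (R / 2) =
        γ' * (S.frame p * trans (R / 2)) * hexStep R ^ j by
      obtain ⟨γ', hγ', j, h⟩ := h
      exact ⟨γ * γ', S.Γ.mul_mem hγ hγ', p, true, j, by rw [h, hexagonFrame]; simp only [mul_assoc]⟩
    induction k with
    | zero => exact ⟨1, S.Γ.one_mem, 0, by simp⟩
    | succ n ih =>
      obtain ⟨γ', hγ', j, h⟩ := ih ⟨_, hγ, p, n, 1, by simp⟩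
      obtain ⟨δ, hδ, h'⟩ := S.exists_mul_trans_mul_hexStep hR p (n + 1)
      rw [add_sub_cancel_right, h, ← eq_mul_inv_iff_mul_eq] at h'
      exact ⟨δ * γ', S.Γ.mul_mem hδ hγ', j - 1, by rw [h', zpow_sub_one]; simp only [mul_assoc]⟩
    | pred n ih =>
      obtain ⟨γ', hγ', j, h⟩ := ih ⟨_, hγ, p, -n, 1, by simp⟩
      obtain ⟨δ, hδ, h'⟩ := S.exists_mul_trans_mul_hexStep hR p (-n)
      rw [h, ← inv_mul_eq_iff_eq_mul] at h'
      exact ⟨δ⁻¹ * γ', S.Γ.mul_mem (S.Γ.inv_mem hδ) hγ', j + 1, by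
        rw [← h', zpow_add_one]; simp only [mul_assoc]⟩

/-- Overlapping hexagons of the tessellation agree. -/
theorem IsSideFrame.eq_mul_hexStep_zpow (hR : 0 < R) {f f' : SL(2, ℝ)} (hf : S.IsSideFrame f)
    (hf' : S.IsSideFrame f') {w : ℍ} (hw : w ∈ openHexagon R f) (hw' : w ∈ openHexagon R f') :
    ∃ k : ℤ, f' = f * hexStep R ^ k := by
  have hint : ∀ (p : S.Pants) (b : Bool),
      openHexagon R (S.hexagonFrame p b) ⊆ interior (pantsHexagon R (S.frame p) b) := by
    rintro p (_ | _) <;> exact openHexagon_subset_interior hR _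
  obtain ⟨γ, hγ, p, b, k, rfl⟩ := hf.exists_hexagonFrame hR
  obtain ⟨γ', hγ', q, c, k', rfl⟩ := hf'.exists_hexagonFrame hR
  rw [openHexagon_mul_hexStep_zpow hR, mem_openHexagon_mul] at hw hw'
  have hproj : ∀ δ ∈ S.Γ, proj S.Γ (δ⁻¹ • w) = proj S.Γ w := fun δ hδ ↦
    Quotient.sound ⟨⟨δ⁻¹, S.Γ.inv_mem hδ⟩, rfl⟩
  obtain ⟨rfl, rfl, hzw⟩ := S.disjoint p q b c _ (hint p b hw) _ (hint q c hw')
    ((hproj γ hγ).trans (hproj γ' hγ').symm)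
  have hfix : (γ' * γ⁻¹) • w = w := by rw [mul_smul, hzw, smul_inv_smul]
  rcases S.isSurfaceGroup.free _ (S.Γ.mul_mem hγ' (S.Γ.inv_mem hγ)) w hfix with h | h
  · rw [mul_inv_eq_one] at h
    exact ⟨k' - k, by rw [h, mul_assoc _ (hexStep R ^ k), ← zpow_add, add_sub_cancel]⟩
  · rw [mul_inv_eq_iff_eq_mul, neg_one_mul] at h
    refine ⟨k' - k + 3, ?_⟩
    rw [h, mul_assoc _ (hexStep R ^ k), ← zpow_add, ← add_assoc, add_sub_cancel, zpow_add,
      hexStep_zpow_three hR]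
    simp

theorem IsSideFrame.proj_mem_cuffs (hR : 0 < R) {f : SL(2, ℝ)} (hf : S.IsSideFrame f) {z : ℍ}
    (hz : offset f z = 0) : proj S.Γ z ∈ S.cuffs := by
  obtain ⟨γ, hγ, p, k, n, rfl⟩ := hf
  obtain ⟨i, hi⟩ := S.exists_cuffFrame hR p k
  rw [offset_smul, offset_mul_trans] at hz
  have hz' : offset (cuffFrame R (S.frame p) i) (γ⁻¹ • z) = 0 := by
    rcases hi with hi | hi
    · rwa [hi] at hz
    · rwa [hi, offset_neg] at hz
  obtain ⟨d, hd⟩ := offset_eq_zero_iff.1 hz'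
  refine Set.mem_iUnion₂.2 ⟨p, i, γ⁻¹ • z, ⟨d, hd.symm⟩, Quotient.sound ⟨⟨γ⁻¹, S.Γ.inv_mem hγ⟩, rfl⟩⟩

theorem exists_isSideFrame_of_proj_mem_cuffs {z : ℍ} (hz : proj S.Γ z ∈ S.cuffs) :
    ∃ f, S.IsSideFrame f ∧ offset f z = 0 := by
  obtain ⟨p, i, w, ⟨d, hd⟩, hw⟩ := Set.mem_iUnion₂.1 hz
  obtain ⟨⟨γ, hγ⟩, hγz⟩ := Quotient.exact hw
  refine ⟨γ⁻¹ * cuffFrame R (S.frame p) i, ⟨γ⁻¹, S.Γ.inv_mem hγ, p, (i : ℕ), 0, ?_⟩, ?_⟩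
  · simp [cuffFrame, trans_zero]
  · rw [offset_smul, inv_inv, offset_eq_zero_iff]
    exact ⟨d, hγz.trans hd.symm⟩

/-- Two hexagons that are adjacent along a seam do not meet the lifts of the cuffs, except along their
sides. -/
theorem IsSideFrame.offset_ne_zero (hR : 0 < R) {f f' : SL(2, ℝ)} (hf : S.IsSideFrame f)
    (hf' : S.IsSideFrame f') {z : ℍ} (hz : z ∈ seamNeighborhood R f) : offset f' z ≠ 0 := by
  intro h0
  obtain ⟨n, hn⟩ := exists_accumulating_openHexagon hR h0
  have hV := isOpen_seamNeighborhood R f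
  obtain ⟨w, ⟨hwV, hwf'⟩, hw0⟩ :
      ∃ w ∈ seamNeighborhood R f ∩ openHexagon R (f' * trans (n * (R / 2))),
        offset (f * leftTurn) w ≠ 0 := by
    obtain ⟨w, hw⟩ := hn _ hV hz
    by_cases h : offset (f * leftTurn) w = 0
    · obtain ⟨w', hw', h⟩ := exists_mem_offset_neg h (hV.inter (isOpen_openHexagon _ _)) hw
      exact ⟨w', hw', h.ne⟩
    · exact ⟨w, hw, h⟩
  have hside : ∀ (g : SL(2, ℝ)) (k : ℤ), f' * trans (n * (R / 2)) = g * hexStep R ^ k →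
      offset g z < 0 → offset (g * hexStep R) z < 0 → offset (g * crossSeam R) z < 0 → False := by
    intro g k hg g1 g2 g3
    rw [← offset_mul_trans f' (n * (R / 2)), hg] at h0
    rcases offset_hexStep_zpow hR g k z with h | h | h <;> linarith
  obtain ⟨h1, h2, h3, h4, -⟩ := hz
  rcases hw0.lt_or_gt with hw0 | hw0
  · have hf₁ : S.IsSideFrame (f * trans (-(R / 2))) := by
      have := hf.mul_trans (-1)
      rwa [show ((-1 : ℤ) : ℝ) * (R / 2) = -(R / 2) by push_cast; ring] at this
    obtain ⟨k, hk⟩ := hf₁.eq_mul_hexStep_zpow hR (hf'.mul_trans n)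
      (mem_openHexagon_of_offset_neg hwV hw0) hwf'
    refine hside _ k hk ?_ ?_ h4
    · rw [offset_mul_trans]; exact h1
    · rw [trans_neg_mul_hexStep]; exact h2
  · obtain ⟨k, hk⟩ := hf.eq_mul_hexStep_zpow hR (hf'.mul_trans n)
      (mem_openHexagon_of_offset_pos hwV hw0) hwf'
    exact hside f k hk h1 h3 h2

end SurfaceOfType

/-! ### Estimates in long hexagons -/

theorem one_div_sinh_le_sinh_seamLength {R : ℝ} (hR : 0 < R) :
    1 / Real.sinh (R / 4) ≤ Real.sinh (seamLength R) := by
  have hs : 0 < Real.sinh (R / 4) := Real.sinh_pos_iff.2 (by linarith)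
  rw [show seamLength R = 2 * (seamLength R / 2) by ring, Real.sinh_two_mul, sinh_half_seamLength]
  have h := Real.one_le_cosh (seamLength R / 2)
  rw [show 1 / Real.sinh (R / 4) = 2 * (1 / (2 * Real.sinh (R / 4))) * 1 by field_simp]
  gcongr

theorem one_le_sinh_seamLength_mul_cosh {R x : ℝ} (hR : 0 < R) (hx : R / 4 ≤ |x|) :
    1 ≤ Real.sinh (seamLength R) * Real.cosh x := by
  have hs : 0 < Real.sinh (R / 4) := Real.sinh_pos_iff.2 (by linarith)
  have h1 : Real.sinh (R / 4) ≤ Real.cosh x :=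
    (Real.sinh_lt_cosh _).le.trans (Real.cosh_le_cosh.2 (by rwa [abs_of_pos (by linarith)]))
  calc (1 : ℝ) = 1 / Real.sinh (R / 4) * Real.sinh (R / 4) := by field_simp
    _ ≤ _ := mul_le_mul (one_div_sinh_le_sinh_seamLength hR) h1 hs.le (sinh_seamLength_pos hR).le

theorem offset_oppositeSeam_le {R : ℝ} (hR : 0 < R) (f : SL(2, ℝ)) (d : ℝ) :
    offset (f * hexStep R * trans (R / 2) * leftTurn) ((f * trans d) • I) ≤ -1 := by
  have hs : 0 < Real.sinh (R / 4) := Real.sinh_pos_iff.2 (by linarith)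
  rw [offset_oppositeSeam hR, neg_le_neg_iff]
  have h1 : 1 ≤ Real.cosh (R / 2) / Real.sinh (R / 4) := by
    rw [one_le_div hs]
    refine (Real.sinh_lt_cosh _).le.trans (Real.cosh_le_cosh.2 ?_)
    rw [abs_of_pos (by linarith), abs_of_pos (by linarith)]
    linarith
  nlinarith [Real.one_le_cosh (d - R / 4)]

theorem sinh_tenth_lt : Real.sinh (1 / 10) < Real.exp (-2) := by
  have h1 : Real.exp (1 / 10) ≤ 10 / 9 := by
    have := Real.add_one_le_exp (-(1 / 10 : ℝ))
    rw [Real.exp_neg] at this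
    rw [show (10 / 9 : ℝ) = (9 / 10)⁻¹ by norm_num, ← inv_inv (Real.exp (1 / 10))]
    exact inv_anti₀ (by norm_num) (by linarith)
  have h2 := Real.add_one_le_exp (-(1 / 10 : ℝ))
  have h3 : Real.exp 2 < 15 / 2 := by
    rw [show (2 : ℝ) = 1 + 1 by norm_num, Real.exp_add]
    nlinarith [Real.exp_one_lt_d9, Real.exp_pos 1]
  have h4 : 2 / 15 < Real.exp (-2) := by
    rw [Real.exp_neg, show (2 / 15 : ℝ) = (15 / 2)⁻¹ by norm_num]
    exact inv_strictAnti₀ (Real.exp_pos 2) h3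
  rw [Real.sinh_eq]
  linarith

/-- The points of a side that are close to the other end of the adjacent seam are far from the
midpoint of the side. -/
theorem abs_le_of_sinh_seamLength_mul_cosh_le {R d : ℝ} (hR : 8 ≤ R)
    (h : Real.sinh (seamLength R) * Real.cosh d ≤ Real.sinh (1 / 10)) : |d| ≤ R / 4 - 2 := by
  by_contra! hd
  have hs : 0 < Real.sinh (R / 4) := Real.sinh_pos_iff.2 (by linarith)
  have h1 : Real.cosh (R / 4 - 2) ≤ Real.cosh d :=
    Real.cosh_le_cosh.2 (by rw [abs_of_nonneg (by linarith)]; exact hd.le)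
  have h2 : Real.exp (R / 4) * Real.exp (-2) / 2 ≤ Real.cosh (R / 4 - 2) := by
    rw [← Real.exp_add, ← sub_eq_add_neg, Real.cosh_eq]
    linarith [Real.exp_pos (-(R / 4 - 2))]
  have h3 : 2 * Real.sinh (R / 4) ≤ Real.exp (R / 4) := by
    rw [Real.sinh_eq]; linarith [Real.exp_pos (-(R / 4))]
  have h4 : Real.sinh (R / 4) * Real.exp (-2) ≤ Real.cosh d := by
    nlinarith [Real.exp_pos (-2)]
  have h5 : 1 / Real.sinh (R / 4) * (Real.sinh (R / 4) * Real.exp (-2)) ≤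
      Real.sinh (seamLength R) * Real.cosh d :=
    mul_le_mul (one_div_sinh_le_sinh_seamLength (by linarith)) h4 (by positivity)
      (sinh_seamLength_pos (by linarith)).le
  rw [← mul_assoc, one_div_mul_cancel hs.ne', one_mul] at h5
  linarith [sinh_tenth_lt]

theorem offset_neg_of_le_neg_one {g h : SL(2, ℝ)} {t τ : ℝ}
    (ht : offset g ((h * trans t) • I) ≤ -1) (hτ : t ≤ τ) (hτ' : τ ≤ t + 1 / 10) :
    offset g ((h * trans τ) • I) < 0 := by
  obtain ⟨-, h2⟩ := offset_add_bounds g h t (sub_nonneg.2 hτ) (Real.sinh_arsinh _).symm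
  rw [add_sub_cancel] at h2
  refine h2.trans_lt ?_
  rw [Real.sinh_neg_iff]
  have h3 : Real.arsinh (offset g ((h * trans t) • I)) < -(1 / 10) := by
    rw [← Real.sinh_lt_sinh, Real.sinh_arsinh, Real.sinh_neg]
    have : Real.exp (-2) ≤ 1 := Real.exp_le_one_iff.2 (by norm_num)
    linarith [sinh_tenth_lt]
  linarith

theorem offset_pos_of_one_le {g h : SL(2, ℝ)} {t τ : ℝ}
    (ht : 1 ≤ offset g ((h * trans t) • I)) (hτ : t ≤ τ) (hτ' : τ ≤ t + 1 / 10) :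
    0 < offset g ((h * trans τ) • I) := by
  have := offset_neg_of_le_neg_one (g := g * rot Real.pi) (h := h) (t := t) (τ := τ)
    (by rw [offset_mul_rot_pi]; linarith) hτ hτ'
  rw [offset_mul_rot_pi] at this
  linarith

/-- A geodesic that starts near the midpoint of the seam-adjacent part of a side and enters the
hexagons on its left stays in them for a while, unless it crosses the opposite end of the seam. -/
theorem mem_seamNeighborhood {R : ℝ} (hR : 4 ≤ R) {f h : SL(2, ℝ)} {t d τ : ℝ}
    (hd : (h * trans t) • I = (f * trans d) • I) (hdR : |d| ≤ R / 4) (hτ : t ≤ τ)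
    (hτ' : τ ≤ t + 1 / 10) (h1 : offset f ((h * trans τ) • I) < 0)
    (h2 : offset (f * crossSeam R) ((h * trans τ) • I) < 0) :
    (h * trans τ) • I ∈ seamNeighborhood R f := by
  have hR0 : 0 < R := by linarith
  obtain ⟨hd1, hd2⟩ := abs_le.1 hdR
  have hback : f * trans d = f * trans (-(R / 2)) * trans (d + R / 2) := by
    rw [mul_assoc, ← trans_add]; ring_nf
  refine ⟨h1, h2, offset_neg_of_le_neg_one ?_ hτ hτ', offset_neg_of_le_neg_one ?_ hτ hτ',
    offset_neg_of_le_neg_one ?_ hτ hτ', offset_pos_of_one_le ?_ hτ hτ',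
    offset_neg_of_le_neg_one ?_ hτ hτ', offset_neg_of_le_neg_one ?_ hτ hτ'⟩ <;> rw [hd]
  · rw [offset_hexStep, neg_le_neg_iff]
    exact one_le_sinh_seamLength_mul_cosh hR0 (by rw [abs_of_neg] <;> linarith)
  · rw [hback, offset_crossSeam, neg_le_neg_iff]
    exact one_le_sinh_seamLength_mul_cosh hR0 (by rw [abs_of_pos] <;> linarith)
  · rw [offset_trans_leftTurn, ← neg_neg (d - R / 2), Real.sinh_neg, neg_le_neg_iff]
    exact le_trans (by linarith) (Real.self_le_sinh_iff.2 (by linarith))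
  · rw [hback, offset_leftTurn]
    exact le_trans (by linarith) (Real.self_le_sinh_iff.2 (by linarith))
  · exact offset_oppositeSeam_le hR0 f d
  · rw [hback]
    exact offset_oppositeSeam_le hR0 _ _

/-- The side frame on the far side of the cuff at the other end of the seam at `f`. -/
noncomputable def nextSide (R : ℝ) (f : SL(2, ℝ)) : SL(2, ℝ) :=
  f * crossSeam R * trans 1 * rot Real.pi

theorem offset_nextSide (R : ℝ) (f : SL(2, ℝ)) (z : ℍ) :
    offset (nextSide R f) z = -offset (f * crossSeam R) z := by
  rw [nextSide, offset_mul_rot_pi, offset_mul_trans]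

/-- The shear: the coordinates along the two cuffs at the ends of a seam differ by `1`. -/
theorem offset_leftTurn_nextSide (R : ℝ) (f : SL(2, ℝ)) (d : ℝ) :
    offset (f * leftTurn) ((nextSide R f * trans d) • I) = Real.sinh (d - 1) := by
  rw [← neg_neg (offset _ _), ← offset_crossSeam_leftTurn R, nextSide, mul_assoc _ (rot _) (trans _),
    rot_pi_mul_trans, ← mul_assoc, mul_smul, rot_smul_I, mul_assoc _ (trans _) (trans _), ← trans_add,
    offset_leftTurn, ← Real.sinh_neg]
  ring_nf

namespace SurfaceOfType

variable {R : ℝ} (S : SurfaceOfType R)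

/-- The times at which the geodesic tangent to `h` meets the lifts of the cuffs. -/
def crossings (h : SL(2, ℝ)) : Set ℝ :=
  {t | ∃ f, S.IsSideFrame f ∧ offset f ((h * trans t) • I) = 0}

/-- The geodesic tangent to `h` is not contained in a lift of a cuff. -/
def IsTransverse (h : SL(2, ℝ)) : Prop :=
  ∀ f, S.IsSideFrame f → ∃ t, offset f ((h * trans t) • I) ≠ 0

/-- The geodesic tangent to `h` crosses the side tangent to `f` at time `t` from right to left, at
distance `d` from the foot of the seam at `f`, the nearest one. -/
structure CrossesAt (h : SL(2, ℝ)) (t : ℝ) (f : SL(2, ℝ)) (d : ℝ) : Prop where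
  isSideFrame : S.IsSideFrame f
  smul_I_eq : (h * trans t) • I = (f * trans d) • I
  abs_coord_le : |d| ≤ R / 4
  left : ∀ τ, t < τ → offset f ((h * trans τ) • I) < 0

variable {S}

theorem exists_crossesAt (hR : 0 < R) {h : SL(2, ℝ)} (hh : S.IsTransverse h) {t : ℝ}
    (ht : t ∈ S.crossings h) : ∃ f d, S.CrossesAt h t f d := by
  obtain ⟨f, hf, h0, hl⟩ : ∃ f, S.IsSideFrame f ∧ offset f ((h * trans t) • I) = 0 ∧
      ∀ τ, t < τ → offset f ((h * trans τ) • I) < 0 := by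
    obtain ⟨f, hf, h0⟩ := ht
    obtain ⟨t₀, ht₀⟩ := hh f hf
    rcases offset_sign_after ht₀ h0 with ⟨hl, -⟩ | ⟨hr, -⟩
    · exact ⟨f, hf, h0, hl⟩
    · have hoff : ∀ z, offset (f * trans 1 * rot Real.pi) z = -offset f z := fun z ↦ by
        rw [offset_mul_rot_pi, offset_mul_trans]
      refine ⟨_, hf.mul_trans_one_mul_rot_pi hR, by rw [hoff, h0, neg_zero], fun τ hτ ↦ ?_⟩
      rw [hoff]
      exact neg_neg_of_pos (hr τ hτ)
  obtain ⟨d, hd⟩ := offset_eq_zero_iff.1 h0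
  refine ⟨_, d - round (d / (R / 2)) * (R / 2), hf.mul_trans (round (d / (R / 2))), ?_, ?_, ?_⟩
  · rw [hd, mul_assoc, ← trans_add, add_sub_cancel]
  · have h1 := abs_sub_round (d / (R / 2))
    have h2 : d - round (d / (R / 2)) * (R / 2) =
        (d / (R / 2) - round (d / (R / 2))) * (R / 2) := by
      rw [sub_mul, div_mul_cancel₀ _ (by linarith)]
    rw [h2, abs_mul, abs_of_pos (show 0 < R / 2 by linarith)]
    nlinarith
  · intro τ hτ
    rw [offset_mul_trans]
    exact hl τ hτ

/-- A geodesic that crosses two cuffs in quick succession does so near a seam, and its position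
relative to the feet of the seams moves by almost `1` from each crossing to the next. -/
theorem CrossesAt.next (hR : 8 ≤ R) {h : SL(2, ℝ)} (hh : S.IsTransverse h) {t d : ℝ} {f : SL(2, ℝ)}
    (hc : S.CrossesAt h t f d) {t' : ℝ} (ht' : t' ∈ S.crossings h) (htt' : t < t')
    (hle : t' ≤ t + 1 / 10) :
    ∃ s e, t < s ∧ s ≤ t' ∧ S.CrossesAt h s (nextSide R f) e ∧ d + 1 - (s - t) ≤ e ∧
      ∀ τ, t < τ → τ < s → τ ∉ S.crossings h := by
  obtain ⟨hf, hd, hdR, hl⟩ := hc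
  have hR0 : 0 < R := by linarith
  have hfX := hf.mul_crossSeam hR0
  have hnot : ∀ τ, t < τ → τ ≤ t + 1 / 10 →
      offset (f * crossSeam R) ((h * trans τ) • I) < 0 → τ ∉ S.crossings h := by
    rintro τ h1 h2 h3 ⟨f', hf', h0⟩
    exact hf.offset_ne_zero hR0 hf' (mem_seamNeighborhood (by linarith) hd hdR h1.le h2 (hl τ h1) h3) h0
  have hstart : offset (f * crossSeam R) ((h * trans t) • I) =
      -(Real.sinh (seamLength R) * Real.cosh d) := by rw [hd, offset_crossSeam]
  have hstart_neg : offset (f * crossSeam R) ((h * trans t) • I) < 0 := by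
    rw [hstart]
    exact neg_neg_of_pos (mul_pos (sinh_seamLength_pos hR0) (Real.cosh_pos d))
  have hend : 0 ≤ offset (f * crossSeam R) ((h * trans t') • I) := by
    by_contra! h0
    exact hnot t' htt' hle h0 ht'
  have hcont : Continuous fun τ ↦ offset (f * crossSeam R) ((h * trans τ) • I) :=
    (continuous_offset _).comp (continuous_smul_trans h)
  obtain ⟨s, ⟨hs1, hs2⟩, hs0⟩ :=
    intermediate_value_Icc htt'.le hcont.continuousOn ⟨hstart_neg.le, hend⟩
  simp only at hs0
  have hts : t < s := hs1.lt_of_ne (by rintro rfl; exact hstart_neg.ne hs0)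
  obtain ⟨t₀, ht₀⟩ := hh _ hfX
  obtain ⟨hpos, hneg⟩ : (∀ τ, s < τ → 0 < offset (f * crossSeam R) ((h * trans τ) • I)) ∧
      ∀ τ, τ < s → offset (f * crossSeam R) ((h * trans τ) • I) < 0 := by
    rcases offset_sign_after ht₀ hs0 with ⟨-, h2⟩ | h2
    · exact absurd (h2 t hts) hstart_neg.not_gt
    · exact h2
  obtain ⟨e, he⟩ := offset_eq_zero_iff.1
    (show offset (nextSide R f) ((h * trans s) • I) = 0 by rw [offset_nextSide, hs0, neg_zero])
  have hdrift := offset_add_bounds (f * leftTurn) h t (sub_nonneg.2 hs1) (D := d)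
    (by rw [hd, offset_leftTurn])
  rw [add_sub_cancel, he, offset_leftTurn_nextSide, Real.sinh_le_sinh, Real.sinh_le_sinh] at hdrift
  have hclose : |d| ≤ R / 4 - 2 := by
    refine abs_le_of_sinh_seamLength_mul_cosh_le hR ?_
    have h1 := (offset_add_bounds (f * crossSeam R) h t (sub_nonneg.2 hs1)
      (Real.sinh_arsinh _).symm).2
    rw [add_sub_cancel, hs0, Real.sinh_nonneg_iff, hstart, Real.arsinh_neg] at h1
    rw [← Real.sinh_arsinh (Real.sinh (seamLength R) * Real.cosh d), Real.sinh_le_sinh]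
    linarith
  obtain ⟨hd1, hd2⟩ := abs_le.1 hclose
  refine ⟨s, e, hts, hs2, ⟨hfX.mul_trans_one_mul_rot_pi hR0, he, ?_, ?_⟩, by linarith, ?_⟩
  · rw [abs_le]
    constructor <;> linarith
  · intro τ hτ
    rw [offset_nextSide]
    exact neg_neg_of_pos (hpos τ hτ)
  · intro τ h1 h2
    exact hnot τ h1 (by linarith) (hneg τ h2)

end SurfaceOfType

namespace SurfaceOfType

variable {R : ℝ} {S : SurfaceOfType R}

/-! ### Counting crossings -/

theorem ncard_crossings_induction (hR : 8 ≤ R) {h : SL(2, ℝ)} (hh : S.IsTransverse h) {t₀ : ℝ}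
    (ht₀ : t₀ ∈ S.crossings h) (k : ℕ) :
    ((S.crossings h ∩ Set.Icc t₀ (t₀ + 1 / 10)).Finite ∧
        (S.crossings h ∩ Set.Icc t₀ (t₀ + 1 / 10)).ncard ≤ k + 1) ∨
      ∃ t f d, t₀ ≤ t ∧ t ≤ t₀ + 1 / 10 ∧ S.CrossesAt h t f d ∧ k - R / 4 - (t - t₀) ≤ d ∧
        (S.crossings h ∩ Set.Icc t₀ t).Finite ∧ (S.crossings h ∩ Set.Icc t₀ t).ncard ≤ k + 1 := by
  induction k with
  | zero =>
    obtain ⟨f, d, hc⟩ := exists_crossesAt (by linarith) hh ht₀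
    have hsub : S.crossings h ∩ Set.Icc t₀ t₀ ⊆ {t₀} := by
      rw [Set.Icc_self]
      exact Set.inter_subset_right
    refine Or.inr ⟨t₀, f, d, le_rfl, by linarith, hc, ?_, (Set.finite_singleton _).subset hsub, ?_⟩
    · have := (abs_le.1 hc.abs_coord_le).1
      push_cast
      linarith
    · exact (Set.ncard_le_ncard hsub).trans (by simp)
  | succ k ih =>
    rcases ih with ⟨h1, h2⟩ | ⟨t, f, d, ht1, ht2, hc, hd, hfin, hcard⟩
    · exact Or.inl ⟨h1, h2.trans (by omega)⟩
    by_cases hex : ∃ t' ∈ S.crossings h, t < t' ∧ t' ≤ t₀ + 1 / 10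
    · obtain ⟨t', ht', htt', hle⟩ := hex
      obtain ⟨s, e, hs1, hs2, hc', he, hgap⟩ := hc.next hR hh ht' htt' (by linarith)
      have hsub : S.crossings h ∩ Set.Icc t₀ s ⊆ insert s (S.crossings h ∩ Set.Icc t₀ t) := by
        rintro τ ⟨hτ, h1, h2⟩
        rcases le_or_gt τ t with h3 | h3
        · exact Or.inr ⟨hτ, h1, h3⟩
        · rcases h2.lt_or_eq with h4 | h4
          · exact absurd hτ (hgap τ h3 h4)
          · exact Or.inl h4
      refine Or.inr ⟨s, _, e, by linarith, by linarith, hc', ?_, (hfin.insert s).subset hsub, ?_⟩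
      · push_cast
        linarith
      · have h1 := Set.ncard_le_ncard hsub (hfin.insert s)
        have h2 := Set.ncard_insert_le s (S.crossings h ∩ Set.Icc t₀ t)
        omega
    · push Not at hex
      have hsub : S.crossings h ∩ Set.Icc t₀ (t₀ + 1 / 10) ⊆ S.crossings h ∩ Set.Icc t₀ t := by
        rintro τ ⟨hτ, h1, h2⟩
        refine ⟨hτ, h1, ?_⟩
        by_contra! h3
        exact (hex τ hτ h3).not_ge h2
      exact Or.inl ⟨hfin.subset hsub, (Set.ncard_le_ncard hsub hfin).trans (by omega)⟩

theorem ncard_crossings_after (hR : 8 ≤ R) {h : SL(2, ℝ)} (hh : S.IsTransverse h) {t₀ : ℝ}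
    (ht₀ : t₀ ∈ S.crossings h) :
    (S.crossings h ∩ Set.Icc t₀ (t₀ + 1 / 10)).Finite ∧
      (S.crossings h ∩ Set.Icc t₀ (t₀ + 1 / 10)).ncard ≤ ⌈R / 2⌉₊ + 2 := by
  rcases ncard_crossings_induction hR hh ht₀ (⌈R / 2⌉₊ + 1) with h1 | ⟨t, f, d, -, ht, hc, hd, -⟩
  · exact h1
  · have h1 := Nat.le_ceil (R / 2)
    have h2 := (abs_le.1 hc.abs_coord_le).2
    push_cast at hd
    linarith

theorem ncard_crossings_window (hR : 8 ≤ R) {h : SL(2, ℝ)} (hh : S.IsTransverse h) (a : ℝ) :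
    (S.crossings h ∩ Set.Icc a (a + 1 / 10)).Finite ∧
      (S.crossings h ∩ Set.Icc a (a + 1 / 10)).ncard ≤ ⌈R / 2⌉₊ + 2 := by
  have hfinset : ∀ u : Finset ℝ, (u : Set ℝ) ⊆ S.crossings h ∩ Set.Icc a (a + 1 / 10) →
      u.card ≤ ⌈R / 2⌉₊ + 2 := by
    intro u hu
    rcases u.eq_empty_or_nonempty with rfl | hne
    · simp
    · have hm := hu (u.min'_mem hne)
      obtain ⟨hfin, hcard⟩ := ncard_crossings_after hR hh hm.1
      refine le_trans ?_ hcard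
      rw [← Set.ncard_coe_finset]
      refine Set.ncard_le_ncard (fun x hx ↦ ⟨(hu hx).1, u.min'_le x hx, ?_⟩) hfin
      linarith [(hu hx).2.2, hm.2.1]
  have hfin : (S.crossings h ∩ Set.Icc a (a + 1 / 10)).Finite := by
    by_contra hinf
    obtain ⟨u, hu, hcard⟩ := Set.Infinite.exists_subset_card_eq hinf (⌈R / 2⌉₊ + 3)
    have := hfinset u hu
    omega
  refine ⟨hfin, ?_⟩
  rw [Set.ncard_eq_toFinset_card _ hfin]
  exact hfinset _ (by rw [hfin.coe_toFinset])

theorem ncard_crossings_le (hR : 8 ≤ R) {h : SL(2, ℝ)} (hh : S.IsTransverse h) {ℓ : ℝ} (hℓ : 0 ≤ ℓ) :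
    (S.crossings h ∩ Set.Icc 0 ℓ).Finite ∧
      ((S.crossings h ∩ Set.Icc 0 ℓ).ncard : ℝ) ≤ 11 * R * max ℓ 1 := by
  set W : ℕ → Set ℝ := fun j ↦ S.crossings h ∩ Set.Icc (j / 10 : ℝ) (j / 10 + 1 / 10) with hW
  set N := ⌊10 * ℓ⌋₊ + 1 with hN
  have hsub : S.crossings h ∩ Set.Icc 0 ℓ ⊆ ⋃ j ∈ Finset.range N, W j := by
    rintro t ⟨ht, h0, h1⟩
    have h2 := Nat.floor_le (show 0 ≤ 10 * t by linarith)
    have h3 := Nat.lt_floor_add_one (10 * t)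
    refine Set.mem_iUnion₂.2 ⟨⌊10 * t⌋₊, ?_, ht, by linarith, by linarith⟩
    rw [Finset.mem_range, hN, Nat.lt_succ_iff]
    exact Nat.floor_le_floor (by linarith)
  have hfin : (⋃ j ∈ Finset.range N, W j).Finite :=
    (Finset.range N).finite_toSet.biUnion fun j _ ↦ (ncard_crossings_window hR hh _).1
  refine ⟨hfin.subset hsub, ?_⟩
  have hcard : (S.crossings h ∩ Set.Icc 0 ℓ).ncard ≤ N * (⌈R / 2⌉₊ + 2) := by
    refine (Set.ncard_le_ncard hsub hfin).trans ((Finset.set_ncard_biUnion_le _ _).trans ?_)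
    refine (Finset.sum_le_card_nsmul _ _ _ fun j _ ↦ (ncard_crossings_window hR hh _).2).trans ?_
    simp
  have hN' : (N : ℝ) ≤ 11 * max ℓ 1 := by
    have := Nat.floor_le (show 0 ≤ 10 * ℓ by linarith)
    rw [hN]
    push_cast
    linarith [le_max_left ℓ 1, le_max_right ℓ 1]
  have hK : ((⌈R / 2⌉₊ + 2 : ℕ) : ℝ) ≤ R := by
    have := Nat.ceil_lt_add_one (show 0 ≤ R / 2 by linarith)
    push_cast
    linarith
  calc ((S.crossings h ∩ Set.Icc 0 ℓ).ncard : ℝ) ≤ (N : ℝ) * ((⌈R / 2⌉₊ + 2 : ℕ) : ℝ) := by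
        exact_mod_cast hcard
    _ ≤ 11 * max ℓ 1 * R := mul_le_mul hN' hK (by positivity) (by positivity)
    _ = 11 * R * max ℓ 1 := by ring

end SurfaceOfType

/-! ### Isometric segments of the hyperbolic plane -/

theorem im_trans_smul_I (t : ℝ) : (trans t • I).im = Real.exp t := by
  rw [← coe_im, coe_trans_smul_I]
  simp [Complex.exp_ofReal_re]

theorem re_trans_smul_I (t : ℝ) : (trans t • I).re = 0 := by
  rw [← coe_re, coe_trans_smul_I]
  simp

theorem dist_trans_smul_I (t : ℝ) : dist I (trans t • I) = |t| := by
  rw [UpperHalfPlane.dist_comm, dist_of_re_eq (by rw [re_trans_smul_I, I_re]), im_trans_smul_I, I_im,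
    Real.log_exp, Real.log_one, Real.dist_eq, sub_zero]

/-- Two points of the hyperbolic plane lie on an oriented geodesic. -/
theorem exists_frame (z w : ℍ) : ∃ h : SL(2, ℝ), z = h • I ∧ w = (h * trans (dist z w)) • I := by
  obtain ⟨f, rfl⟩ := MulAction.exists_smul_eq SL(2, ℝ) I z
  have hI : ∀ θ, f • I = (f * rot θ) • I := fun θ ↦ by rw [mul_smul, rot_smul_I]
  have hcont : Continuous fun θ ↦ offset (f * rot θ) w := by
    obtain ⟨m, rfl⟩ := exists_eq_mul_smul_I f w
    have : ∀ θ, offset (f * rot θ) ((f * m) • I) =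
        (Real.cos (θ / 2) * m 0 0 - Real.sin (θ / 2) * m 1 0) *
            (Real.sin (θ / 2) * m 0 0 + Real.cos (θ / 2) * m 1 0) +
          (Real.cos (θ / 2) * m 0 1 - Real.sin (θ / 2) * m 1 1) *
            (Real.sin (θ / 2) * m 0 1 + Real.cos (θ / 2) * m 1 1) := by
      intro θ
      rw [show f * m = f * rot θ * ((rot θ)⁻¹ * m) by group, offset_mul_smul_I,
        Matrix.SpecialLinearGroup.coe_mul, Matrix.SpecialLinearGroup.coe_inv, coe_rot,
        Matrix.adjugate_fin_two_of]
      simp [Matrix.mul_apply, Fin.sum_univ_two]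
      ring
    simp only [this]
    fun_prop
  obtain ⟨θ, hθ⟩ : ∃ θ, offset (f * rot θ) w = 0 := by
    have hflip : offset (f * rot Real.pi) w = -offset (f * rot 0) w := by
      have h0 : rot 0 = 1 := by
        ext i j
        rw [coe_rot]
        fin_cases i <;> fin_cases j <;> simp
      rw [offset_mul_rot_pi, h0, mul_one]
    rcases le_total 0 (offset (f * rot 0) w) with h | h
    · exact mem_range_of_exists_le_of_exists_ge hcont ⟨Real.pi, by linarith⟩ ⟨0, h⟩
    · exact mem_range_of_exists_le_of_exists_ge hcont ⟨0, h⟩ ⟨Real.pi, by linarith⟩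
  obtain ⟨d, rfl⟩ := offset_eq_zero_iff.1 hθ
  have hdist : dist (f • I) ((f * rot θ * trans d) • I) = |d| := by
    rw [hI θ, mul_smul (f * rot θ), dist_smul, dist_trans_smul_I]
  rw [hdist]
  rcases abs_cases d with ⟨h, -⟩ | ⟨h, -⟩ <;> rw [h]
  · exact ⟨f * rot θ, hI θ, rfl⟩
  · refine ⟨f * rot θ * rot Real.pi, ?_, ?_⟩
    · rw [mul_smul _ (rot Real.pi), rot_smul_I, ← hI]
    · rw [mul_assoc _ (rot Real.pi), rot_pi_mul_trans, neg_neg, ← mul_assoc, mul_smul _ (rot Real.pi),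
        rot_smul_I]

theorem eq_trans_smul_I {z : ℍ} {t ℓ : ℝ} (hℓ : 0 < ℓ) (h1 : dist I z = t)
    (h2 : dist z (trans ℓ • I) = ℓ - t) : z = trans t • I := by
  have hy := z.im_pos
  have c1 := cosh_dist' I z
  have c2 := cosh_dist' z (trans ℓ • I)
  rw [h1, I_re, I_im, Real.cosh_eq, Real.exp_neg] at c1
  rw [h2, re_trans_smul_I, im_trans_smul_I, Real.cosh_eq, neg_sub, Real.exp_sub, Real.exp_sub] at c2
  have hE : 1 < Real.exp ℓ := Real.one_lt_exp_iff.2 hℓ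
  have hT := Real.exp_pos t
  generalize Real.exp ℓ = E at *
  have hz : z.re = 0 ∧ z.im = Real.exp t := by
    generalize Real.exp t = T at *
    generalize z.im = y at *
    generalize z.re = x at *
    field_simp at c1 c2
    have hyT : y = T := by
      have hE2 : E ^ 2 - 1 ≠ 0 := by nlinarith
      apply mul_left_cancel₀ hE2
      linear_combination c2 - c1
    subst hyT
    refine ⟨?_, rfl⟩
    have : y * x ^ 2 = 0 := by nlinarith
    rcases mul_eq_zero.1 this with h | h
    · exact absurd h hy.ne'
    · exact pow_eq_zero_iff two_ne_zero |>.1 h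
  apply UpperHalfPlane.ext
  apply Complex.ext
  · rw [coe_re, coe_re, re_trans_smul_I, hz.1]
  · rw [coe_im, coe_im, im_trans_smul_I, hz.2]

theorem exists_frame_of_isometry {ℓ : ℝ} (hℓ : 0 ≤ ℓ) {g : Set.Icc (0 : ℝ) ℓ → ℍ}
    (hg : Isometry g) : ∃ h : SL(2, ℝ), ∀ t, g t = (h * trans t) • I := by
  have hdist : ∀ s t, s ≤ t → dist (g s) (g t) = t - s := fun s t hst ↦ by
    rw [hg.dist_eq, Subtype.dist_eq, Real.dist_eq, abs_sub_comm, abs_of_nonneg]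
    exact sub_nonneg.2 hst
  set t₀ : Set.Icc (0 : ℝ) ℓ := ⟨0, le_rfl, hℓ⟩
  set t₁ : Set.Icc (0 : ℝ) ℓ := ⟨ℓ, hℓ, le_rfl⟩
  obtain ⟨h, h0, h1⟩ := exists_frame (g t₀) (g t₁)
  rw [hdist t₀ t₁ hℓ, sub_zero] at h1
  refine ⟨h, fun t ↦ ?_⟩
  rcases hℓ.eq_or_lt with rfl | hpos
  · have ht : (t : ℝ) = 0 := le_antisymm t.2.2 t.2.1
    rw [ht, trans_zero, mul_one, ← h0, show t = t₀ from Subtype.ext ht]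
  · rw [mul_smul, ← inv_smul_eq_iff]
    have d0 := hdist t₀ t t.2.1
    have d1 := hdist t t₁ t.2.2
    refine eq_trans_smul_I hpos ?_ ?_
    · rw [← dist_smul h, smul_inv_smul, ← h0, d0]
      exact sub_zero _
    · rw [← dist_smul h, smul_inv_smul, ← mul_smul, ← h1, d1]

end HypSurf

theorem propositionP :
    ∃ R₀ C : ℝ, ∀ R : ℝ, R₀ ≤ R → ∀ S : HypSurf.SurfaceOfType R,
      ∀ ℓ : ℝ, 0 ≤ ℓ → ∀ c : Set.Icc (0 : ℝ) ℓ → S.carrier, S.IsGeodesicSegment ℓ c →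
        ¬ Set.range c ⊆ S.cuffs →
          {t | c t ∈ S.cuffs}.Finite ∧
            ({t | c t ∈ S.cuffs}.ncard : ℝ) ≤ C * R * max ℓ 1 := by
  refine ⟨8, 11, fun R hR S ℓ hℓ c ⟨g, hg, hc⟩ hnot ↦ ?_⟩
  have hR0 : 0 < R := by linarith
  obtain ⟨h, hh⟩ := HypSurf.exists_frame_of_isometry hℓ hg
  have htrans : S.IsTransverse h := by
    intro f hf
    by_contra! hzero
    refine hnot ?_
    rintro _ ⟨t, rfl⟩
    rw [hc, hh]
    exact hf.proj_mem_cuffs hR0 (hzero t)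
  obtain ⟨hfin, hcard⟩ := HypSurf.SurfaceOfType.ncard_crossings_le hR htrans hℓ
  have hsub : Subtype.val '' {t | c t ∈ S.cuffs} ⊆ S.crossings h ∩ Set.Icc 0 ℓ := by
    rintro _ ⟨t, ht, rfl⟩
    rw [Set.mem_ofPred_eq, hc, hh] at ht
    exact ⟨HypSurf.SurfaceOfType.exists_isSideFrame_of_proj_mem_cuffs ht, t.2⟩
  refine ⟨Set.Finite.of_finite_image (hfin.subset hsub) Subtype.val_injective.injOn, ?_⟩
  rw [← Set.ncard_image_of_injective _ Subtype.val_injective]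
  refine le_trans ?_ hcard
  exact_mod_cast Set.ncard_le_ncard hsub hfin
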